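/- Let $n\ge 1$ and let $M$ be a connected (Hausdorff) smooth manifold of dimension $2n+1$. Let $\mathcal D\subset TM$ be a contact distribution, i.e. near every point $\mathcal D=\ker\alpha$ for some nowhere vanishing smooth one-form $\alpha$ such that $d\alpha|_{\mathcal D}$ is nondegenerate, and let $g$ be a smooth pseudo-Riemannian metric on $\mathcal D$, i.e. a smoothly varying nondegenerate symmetric bilinear form, of arbitrary signature, on each $\mathcal D_q$. A diffeomorphism $f\colon M\to M$ is called an isometry of $(M,\mathcal D,g)$ if for every $q\in M$ (i) $d_qf(\mathcal D_q)=\mathcal D_{f(q)}$, and (ii) $g_{f(q)}(d_qf(v),d_qf(w))=g_q(v,w)$ for all $v,w\in\mathcal D_q$. **Proposition.** Any isometry $f$ of $(M,\mathcal D,g)$ is uniquely determined by $f(q_0)$ and $d_{q_0}f$, where $q_0\in M$ is an arbitrary fixed point: if $f_1,f_2$ are isometries of $(M,\mathcal D,g)$ and, for some $q_0\in M$, $f_1(q_0)=f_2(q_0)$ and $d_{q_0}f_1=d_{q_0}f_2$, then $f_1=f_2$. -/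

import Mathlib

open scoped Manifold ContDiff

noncomputable section

namespace ContactSPR

variable {n : ℕ} {M : Type*} [TopologicalSpace M]
  [ChartedSpace (EuclideanSpace ℝ (Fin (2 * n + 1))) M]

variable (n M) in
/-- A (not necessarily smooth) one-form on `M`: a linear functional on each tangent space. -/
abbrev OneForm : Type _ := ∀ q : M, TangentSpace (𝓡 (2 * n + 1)) q →L[ℝ] ℝ

variable (n M) in
/-- A field of tangent subspaces on `M`. -/
abbrev Distribution : Type _ := ∀ q : M, Submodule ℝ (TangentSpace (𝓡 (2 * n + 1)) q)

/-- The one-form `α` is smooth on `U`, as a section of the cotangent bundle. -/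
def OneForm.SmoothOn [IsManifold (𝓡 (2 * n + 1)) ∞ M] (α : OneForm n M) (U : Set M) : Prop :=
  ContMDiffOn (𝓡 (2 * n + 1))
    ((𝓡 (2 * n + 1)).prod 𝓘(ℝ, EuclideanSpace ℝ (Fin (2 * n + 1)) →L[ℝ] ℝ)) ∞
    (fun q ↦ Bundle.TotalSpace.mk' (EuclideanSpace ℝ (Fin (2 * n + 1)) →L[ℝ] ℝ)
      (E := fun q : M ↦ TangentSpace (𝓡 (2 * n + 1)) q →L[ℝ] Bundle.Trivial M ℝ q) q (α q)) U

/-- The one-form `α` read in the preferred chart around `q`, i.e. its pullback under the inverse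
chart, as a one-form on (an open subset of) `ℝ²ⁿ⁺¹`. -/
def OneForm.inChart (α : OneForm n M) (q : M) (y : EuclideanSpace ℝ (Fin (2 * n + 1))) :
    EuclideanSpace ℝ (Fin (2 * n + 1)) →L[ℝ] ℝ :=
  (α ((extChartAt (𝓡 (2 * n + 1)) q).symm y)).comp
    (mfderiv (𝓡 (2 * n + 1)) (𝓡 (2 * n + 1)) (extChartAt (𝓡 (2 * n + 1)) q).symm y)

/-- The value `dα_q(v, w)` of the exterior derivative of the one-form `α`, computed in the preferred
chart around `q`. For `α` smooth near `q` the result is the same in every chart. -/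
def OneForm.d (α : OneForm n M) (q : M) (v w : TangentSpace (𝓡 (2 * n + 1)) q) : ℝ :=
  extDeriv
    (fun y ↦ ContinuousAlternatingMap.ofSubsingleton ℝ (EuclideanSpace ℝ (Fin (2 * n + 1))) ℝ
      (0 : Fin 1) (α.inChart q y))
    (extChartAt (𝓡 (2 * n + 1)) q q)
    ![mfderiv (𝓡 (2 * n + 1)) (𝓡 (2 * n + 1)) (extChartAt (𝓡 (2 * n + 1)) q) q v,
      mfderiv (𝓡 (2 * n + 1)) (𝓡 (2 * n + 1)) (extChartAt (𝓡 (2 * n + 1)) q) q w]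

/-- `D` is a contact distribution: near every point it is the kernel of a nowhere vanishing smooth
one-form `α` such that `dα` is nondegenerate on `D`. (No global `α`, that is no coorientation,
is required.) -/
def IsContactDistribution [IsManifold (𝓡 (2 * n + 1)) ∞ M] (D : Distribution n M) : Prop :=
  ∀ p : M, ∃ U : Set M, IsOpen U ∧ p ∈ U ∧ ∃ α : OneForm n M, α.SmoothOn U ∧
    ∀ q ∈ U, α q ≠ 0 ∧ (∀ v, v ∈ D q ↔ α q v = 0) ∧
      ∀ v ∈ D q, (∀ w ∈ D q, α.d q v w = 0) → v = 0

/-- The section `X` of the distribution `D` is smooth on `U`, as a vector field on `M`. -/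
def SmoothSectionOn {D : Distribution n M} [IsManifold (𝓡 (2 * n + 1)) ∞ M] (X : ∀ q, D q)
    (U : Set M) : Prop :=
  ContMDiffOn (𝓡 (2 * n + 1)) (𝓡 (2 * n + 1)).tangent ∞
    (fun q ↦ (⟨q, (X q : TangentSpace (𝓡 (2 * n + 1)) q)⟩ : TangentBundle (𝓡 (2 * n + 1)) M)) U

variable (n M) in
/-- A contact sub-pseudo-Riemannian structure `(D, g)` on a `(2n+1)`-dimensional manifold `M`:
a contact distribution `D` with a smooth pseudo-Riemannian metric `g` on it (a symmetric
nondegenerate bilinear form on each `D q`, of any signature, such that `g(X, Y)` is smooth for all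
smooth local sections `X`, `Y` of `D`). -/
structure Structure [IsManifold (𝓡 (2 * n + 1)) ∞ M] where
  D : Distribution n M
  contact : IsContactDistribution D
  g : ∀ q : M, LinearMap.BilinForm ℝ (D q)
  symm : ∀ q, (g q).IsSymm
  nondegenerate : ∀ q, (g q).Nondegenerate
  smooth : ∀ U : Set M, IsOpen U → ∀ X Y : ∀ q, D q, SmoothSectionOn X U → SmoothSectionOn Y U →
    ContMDiffOn (𝓡 (2 * n + 1)) 𝓘(ℝ, ℝ) ∞ (fun q ↦ g q (X q) (Y q)) U

/-- The diffeomorphism `f` is an isometry of `(M, D, g)`: its differential maps `D q` onto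
`D (f q)` and preserves `g`. -/
structure IsIsometry [IsManifold (𝓡 (2 * n + 1)) ∞ M] (S : Structure n M)
    (f : Diffeomorph (𝓡 (2 * n + 1)) (𝓡 (2 * n + 1)) M M ∞) : Prop where
  map_eq : ∀ q : M,
    (S.D q).map (mfderiv (𝓡 (2 * n + 1)) (𝓡 (2 * n + 1)) f q).toLinearMap = S.D (f q)
  isometry : ∀ (q : M) (v w : S.D q),
    S.g (f q)
      ⟨mfderiv (𝓡 (2 * n + 1)) (𝓡 (2 * n + 1)) f q v, map_eq q ▸ Submodule.mem_map_of_mem v.2⟩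
      ⟨mfderiv (𝓡 (2 * n + 1)) (𝓡 (2 * n + 1)) f q w, map_eq q ▸ Submodule.mem_map_of_mem w.2⟩
      = S.g q v w

end ContactSPR

end

set_option maxSynthPendingDepth 3

/-! The map `φ = f₁⁻¹ ∘ f₂` preserves the structure and has the one-jet of the identity at `q₀`. It
suffices to prove local rigidity: such a `φ` is the identity near every point where it has the
one-jet of the identity. The set of points near which `φ` is the identity is then open, closed
(one-jets pass to the limit) and nonempty, hence everything (`eq_id_of_local_rigidity`).

For local rigidity, write `D = ker a` in a chart, so that `φ^* a = l a`. The metric selects a scale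
for `a`. On the hyperplane, of dimension `N`, the quotient of the Gram determinants of `da` and of
the metric does not depend on the frame, and under `φ` it is multiplied by `l ^ N`. A suitable root
of it gives a factor `r > 0` with `|l| (r ∘ φ) = r` (`exists_normalization`); since `l = 1` at the
base point, `φ` preserves the form `r a` itself near it.

A map preserving a contact form preserves its Reeb field, hence the splitting of the tangent space
into the Reeb line and the contact hyperplane. So the metric on the hyperplane plus the square of
the form is a `φ`-invariant pseudo-Riemannian metric on the whole space
(`eventually_eq_id_of_preserves_form`).

For such a metric, the Koszul formula expresses `D²φ` through the difference between the first
derivative of the metric and its pullback. Hence `D²φ` is bounded by a multiple of the distance of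
the one-jet of `φ` to that of the identity, and Gronwall's inequality along rays gives `φ = id`
without geodesics (`eventually_eq_id_of_preserves_metric`). -/

namespace ContactSPR

/-! ### Rigidity of metrics on a normed space: Koszul formula and Gronwall inequality. -/

section Euclidean

open Filter Topology

variable {E : Type*} [NormedAddCommGroup E] [NormedSpace ℝ E]

/-- The derivative of the invariance relation `G (φ x) (Dφ v) (Dφ w) = G x v w`. -/
theorem fderiv_pullback_metric {G : E → E →L[ℝ] E →L[ℝ] ℝ} {φ : E → E} {x : E}
    (hG : DifferentiableAt ℝ G x) (hGφ : DifferentiableAt ℝ G (φ x)) (hφ : ContDiffAt ℝ 2 φ x)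
    (hinv : ∀ᶠ y in 𝓝 x, ∀ v w, G (φ y) (fderiv ℝ φ y v) (fderiv ℝ φ y w) = G y v w)
    (u v w : E) :
    fderiv ℝ G (φ x) (fderiv ℝ φ x u) (fderiv ℝ φ x v) (fderiv ℝ φ x w)
      + G (φ x) (fderiv ℝ (fderiv ℝ φ) x u v) (fderiv ℝ φ x w)
      + G (φ x) (fderiv ℝ φ x v) (fderiv ℝ (fderiv ℝ φ) x u w) = fderiv ℝ G x u v w := by
  have hφ1 : HasFDerivAt φ (fderiv ℝ φ x) x := (hφ.differentiableAt (by norm_num)).hasFDerivAt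
  have hφ2 : HasFDerivAt (fderiv ℝ φ) (fderiv ℝ (fderiv ℝ φ) x) x :=
    ((hφ.fderiv_right (m := 1) (by norm_num)).differentiableAt (by norm_num)).hasFDerivAt
  have hc : HasFDerivAt (fun y ↦ G (φ y)) _ x := HasFDerivAt.comp (g := G) x hGφ.hasFDerivAt hφ1
  have hl := (hc.clm_apply (hφ2.clm_apply (hasFDerivAt_const v x))).clm_apply
    (hφ2.clm_apply (hasFDerivAt_const w x))
  have hr := (hG.hasFDerivAt.clm_apply (hasFDerivAt_const v x)).clm_apply (hasFDerivAt_const w x)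
  have h := hl.congr_of_eventuallyEq (f₁ := fun y ↦ G y v w)
    (by filter_upwards [hinv] with y hy using (hy v w).symm)
  have := congrArg (fun L : E →L[ℝ] ℝ ↦ L u) (h.unique hr)
  simp at this
  linarith

/-- The Koszul formula for the second derivative of a map preserving a metric. -/
theorem koszul_second_fderiv {G : E → E →L[ℝ] E →L[ℝ] ℝ} {φ : E → E} {x : E}
    (hG : DifferentiableAt ℝ G x) (hGφ : DifferentiableAt ℝ G (φ x)) (hφ : ContDiffAt ℝ 2 φ x)
    (hsymm : ∀ v w, G (φ x) v w = G (φ x) w v)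
    (hinv : ∀ᶠ y in 𝓝 x, ∀ v w, G (φ y) (fderiv ℝ φ y v) (fderiv ℝ φ y w) = G y v w)
    {S : E → E → E → ℝ} (hS : ∀ u v w, S u v w = fderiv ℝ G x u v w
      - fderiv ℝ G (φ x) (fderiv ℝ φ x u) (fderiv ℝ φ x v) (fderiv ℝ φ x w)) (u v w : E) :
    2 * G (φ x) (fderiv ℝ (fderiv ℝ φ) x u v) (fderiv ℝ φ x w)
      = S u v w + S v u w - S w u v := by
  -- Symmetry of `D²φ` plays the role of torsion-freeness in the usual Koszul argument: the
  -- alternating sum of three permuted identities isolates one second-derivative term.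
  have h2 : ∀ u v, fderiv ℝ (fderiv ℝ φ) x u v = fderiv ℝ (fderiv ℝ φ) x v u := fun u v ↦
    (hφ.isSymmSndFDerivAt (by simp)).eq u v
  have key := fderiv_pullback_metric hG hGφ hφ hinv
  have e1 := key u v w
  have e2 := key v u w
  have e3 := key w u v
  rw [hS, hS, hS, ← e1, ← e2, ← e3, h2 v u, h2 w u, h2 w v,
    hsymm (fderiv ℝ φ x u), hsymm (fderiv ℝ φ x v)]
  ring

/-- The difference of a trilinear form and the pullback of another one. -/
theorem norm_trilinear_sub_pullback_le (T T' : E →L[ℝ] E →L[ℝ] E →L[ℝ] ℝ) (A : E →L[ℝ] E)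
    {δ K : ℝ} (hT : ‖T - T'‖ ≤ K * δ) (hT' : ‖T'‖ ≤ K) (hA : ‖A‖ ≤ 2)
    (hA1 : ‖ContinuousLinearMap.id ℝ E - A‖ ≤ δ) (u v w : E) :
    |T u v w - T' (A u) (A v) (A w)| ≤ 8 * K * δ * (‖u‖ * ‖v‖ * ‖w‖) := by
  have hK : 0 ≤ K := (norm_nonneg _).trans hT'
  have hδ : 0 ≤ δ := (norm_nonneg _).trans hA1
  have tri : ∀ (R : E →L[ℝ] E →L[ℝ] E →L[ℝ] ℝ) {k : ℝ}, ‖R‖ ≤ k → ∀ a b c {a' b' c' : ℝ},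
      ‖a‖ ≤ a' → ‖b‖ ≤ b' → ‖c‖ ≤ c' → |R a b c| ≤ k * a' * b' * c' := by
    intro R k hk a b c a' b' c' ha hb hc
    have h0 : 0 ≤ k := (norm_nonneg _).trans hk
    have h1 : ‖R a‖ ≤ k * a' := (R.le_opNorm a).trans (by gcongr)
    have h1' := (norm_nonneg _).trans h1
    have h2 : ‖R a b‖ ≤ k * a' * b' := ((R a).le_opNorm b).trans (by gcongr)
    have h2' := (norm_nonneg _).trans h2
    exact ((R a b).le_opNorm c).trans (by gcongr)
  have hAn : ∀ z, ‖A z‖ ≤ 2 * ‖z‖ := fun z ↦ (A.le_opNorm z).trans (by gcongr)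
  have hAd : ∀ z, ‖z - A z‖ ≤ δ * ‖z‖ := fun z ↦
    ((ContinuousLinearMap.id ℝ E - A).le_opNorm z).trans (by gcongr)
  -- Telescoping: replace `T` by `T'`, then the arguments one at a time. With `‖A‖ ≤ 2` the four
  -- terms contribute `1 + 1 + 2 + 4 = 8` times `K * δ`.
  have e : T u v w - T' (A u) (A v) (A w) = (T - T') u v w + T' (u - A u) v w
      + T' (A u) (v - A v) w + T' (A u) (A v) (w - A w) := by
    simp
  have b1 := tri (T - T') hT u v w le_rfl le_rfl le_rfl
  have b2 := tri T' hT' (u - A u) v w (hAd u) le_rfl le_rfl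
  have b3 := tri T' hT' (A u) (v - A v) w (hAn u) (hAd v) le_rfl
  have b4 := tri T' hT' (A u) (A v) (w - A w) (hAn u) (hAn v) (hAd w)
  rw [e]
  calc _ ≤ |(T - T') u v w| + |T' (u - A u) v w| + |T' (A u) (v - A v) w|
        + |T' (A u) (A v) (w - A w)| := by
        refine (abs_add_le _ _).trans ?_
        gcongr
        exact abs_add_three _ _ _
    _ ≤ _ := by linarith

/-- Gronwall's inequality along rays: a map with the one-jet of the identity at `x₀` whose second
derivative is controlled by its distance to the identity is the identity near `x₀`. -/
theorem eventually_eq_id_of_norm_second_fderiv_le {φ : E → E} {x₀ : E} {C : ℝ}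
    (hφ : ContDiffAt ℝ 2 φ x₀) (h0 : φ x₀ = x₀) (h1 : fderiv ℝ φ x₀ = ContinuousLinearMap.id ℝ E)
    (hb : ∀ᶠ x in 𝓝 x₀, ‖fderiv ℝ (fderiv ℝ φ) x‖ ≤
      C * max ‖φ x - x‖ ‖fderiv ℝ φ x - ContinuousLinearMap.id ℝ E‖) :
    ∀ᶠ x in 𝓝 x₀, φ x = x := by
  have hev := (hφ.eventually (by simp)).and hb
  obtain ⟨ε, hε, hball⟩ := Metric.eventually_nhds_iff_ball.1 hev
  filter_upwards [Metric.ball_mem_nhds x₀ hε] with x hx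
  set v := x - x₀ with hv
  let γ : ℝ → E := fun t ↦ x₀ + t • v
  have hγ : ∀ t ∈ Set.Icc (0 : ℝ) 1, γ t ∈ Metric.ball x₀ ε := by
    intro t ht
    rw [mem_ball_iff_norm] at hx ⊢
    have : γ t - x₀ = t • v := by simp [γ]
    rw [this, norm_smul, Real.norm_of_nonneg ht.1]
    nlinarith [norm_nonneg v, ht.2]
  have hγ' : ∀ t, HasDerivAt γ v t := fun t ↦ by
    simpa [γ] using ((hasDerivAt_id t).smul_const v).const_add x₀
  -- The deviation of the one-jet from the identity along the ray. It vanishes at `t = 0` and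
  -- satisfies a linear differential inequality, with constant `1` in the first component and `C` in
  -- the second.
  let z : ℝ → E × (E →L[ℝ] E) := fun t ↦
    (φ (γ t) - γ t, fderiv ℝ φ (γ t) - ContinuousLinearMap.id ℝ E)
  let z' : ℝ → E × (E →L[ℝ] E) := fun t ↦
    (fderiv ℝ φ (γ t) v - v, fderiv ℝ (fderiv ℝ φ) (γ t) v)
  have hz : ∀ t ∈ Set.Icc (0 : ℝ) 1, HasDerivAt z (z' t) t := by
    intro t ht
    have hc := (hball _ (hγ t ht)).1
    have d1 : HasFDerivAt φ (fderiv ℝ φ (γ t)) (γ t) :=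
      (hc.differentiableAt (by norm_num)).hasFDerivAt
    have d2 : HasFDerivAt (fderiv ℝ φ) (fderiv ℝ (fderiv ℝ φ) (γ t)) (γ t) :=
      ((hc.fderiv_right (m := 1) (by norm_num)).differentiableAt (by norm_num)).hasFDerivAt
    exact ((d1.comp_hasDerivAt t (hγ' t)).sub (hγ' t)).prodMk
      ((d2.comp_hasDerivAt t (hγ' t)).sub_const _)
  have hbound : ∀ t ∈ Set.Ico (0 : ℝ) 1, ‖z' t‖ ≤ (max 1 C * ‖v‖) * ‖z t‖ + 0 := by
    intro t ht
    have hb := (hball _ (hγ t ⟨ht.1, ht.2.le⟩)).2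
    have hzn : ‖z t‖ = max ‖φ (γ t) - γ t‖ ‖fderiv ℝ φ (γ t) - ContinuousLinearMap.id ℝ E‖ := rfl
    rw [← hzn] at hb
    rw [add_zero]
    refine max_le ?_ ?_
    · calc ‖fderiv ℝ φ (γ t) v - v‖ = ‖(fderiv ℝ φ (γ t) - ContinuousLinearMap.id ℝ E) v‖ := by
            simp
        _ ≤ ‖z t‖ * ‖v‖ := (ContinuousLinearMap.le_opNorm _ _).trans (by
            gcongr; rw [hzn]; exact le_max_right _ _)
        _ ≤ (max 1 C * ‖v‖) * ‖z t‖ := by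
            nlinarith [le_max_left 1 C, mul_nonneg (norm_nonneg (z t)) (norm_nonneg v)]
    · calc ‖fderiv ℝ (fderiv ℝ φ) (γ t) v‖ ≤ (C * ‖z t‖) * ‖v‖ :=
            (ContinuousLinearMap.le_opNorm _ _).trans (by gcongr)
        _ ≤ (max 1 C * ‖v‖) * ‖z t‖ := by
            nlinarith [le_max_right 1 C, mul_nonneg (norm_nonneg (z t)) (norm_nonneg v)]
  have hgr := norm_le_gronwallBound_of_norm_deriv_right_le (f := z) (f' := z') (δ := 0)
    (a := 0) (b := 1)
    (fun t ht ↦ (hz t ht).continuousAt.continuousWithinAt)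
    (fun t ht ↦ (hz t ⟨ht.1, ht.2.le⟩).hasDerivWithinAt)
    (by simp [z, γ, h0, h1]) hbound 1 (by simp)
  rw [gronwallBound_ε0_δ0] at hgr
  have : z 1 = 0 := norm_le_zero_iff.1 hgr
  have h := congrArg Prod.fst this
  simpa [z, γ, hv, sub_eq_zero] using h

/-- A local isometry of a pseudo-Riemannian metric having the one-jet of the identity at a point is
the identity near that point. -/
theorem eventually_eq_id_of_preserves_metric [FiniteDimensional ℝ E]
    {G : E → E →L[ℝ] E →L[ℝ] ℝ} {φ : E → E} {x₀ : E}
    (hG : ContDiffAt ℝ 2 G x₀) (hφ : ContDiffAt ℝ 2 φ x₀)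
    (h0 : φ x₀ = x₀) (h1 : fderiv ℝ φ x₀ = ContinuousLinearMap.id ℝ E)
    (hsymm : ∀ᶠ x in 𝓝 x₀, ∀ v w, G x v w = G x w v)
    (hnd : ∀ v, G x₀ v = 0 → v = 0)
    (hinv : ∀ᶠ x in 𝓝 x₀, ∀ v w, G (φ x) (fderiv ℝ φ x v) (fderiv ℝ φ x w) = G x v w) :
    ∀ᶠ x in 𝓝 x₀, φ x = x := by
  have hφc : Tendsto φ (𝓝 x₀) (𝓝 x₀) := by simpa [ContinuousAt, h0] using hφ.continuousAt
  have hDφ : ContDiffAt ℝ 1 (fderiv ℝ φ) x₀ := hφ.fderiv_right (by norm_num)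
  have hDG : ContDiffAt ℝ 1 (fderiv ℝ G) x₀ := hG.fderiv_right (by norm_num)
  -- lower bound for the metric
  obtain ⟨c, hc, hlow⟩ : ∃ c > 0, ∀ y, c * ‖y‖ ≤ ‖G x₀ y‖ := by
    obtain ⟨K, hK, hanti⟩ := (G x₀).toLinearMap.exists_antilipschitzWith
      (LinearMap.ker_eq_bot'.2 hnd)
    refine ⟨(K : ℝ)⁻¹, by positivity, fun y ↦ ?_⟩
    have := hanti.le_mul_norm_sub y 0
    have hK' : (0 : ℝ) < K := by exact_mod_cast hK
    rw [inv_mul_le_iff₀ hK']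
    simpa using this
  -- The Koszul formula controls `D²φ` only after pairing with `Dφ w`, that is, through `H`. As `H
  -- x₀ = G x₀`, half of the lower bound `c` survives near `x₀`.
  let H : E → E →L[ℝ] E →L[ℝ] ℝ := fun x ↦
    (ContinuousLinearMap.compL ℝ E E ℝ).flip (fderiv ℝ φ x) ∘L G (φ x)
  have hHc : ContinuousAt H x₀ := by
    have : ContinuousAt (fun x ↦ G (φ x)) x₀ :=
      ContinuousAt.comp (by rw [h0]; exact hG.continuousAt) hφ.continuousAt
    exact (((ContinuousLinearMap.compL ℝ E E ℝ).flip.continuous.continuousAt.comp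
      hDφ.continuousAt).clm_comp this)
  have hH0 : H x₀ = G x₀ := by ext; simp [H, h0, h1]
  have hHlow : ∀ᶠ x in 𝓝 x₀, ∀ y, c / 2 * ‖y‖ ≤ ‖H x y‖ := by
    have := hHc.eventually (Metric.ball_mem_nhds (H x₀) (half_pos hc))
    filter_upwards [this] with x hx y
    rw [dist_eq_norm, hH0] at hx
    have e : G x₀ y = H x y - (H x - G x₀) y := by simp
    have := (hlow y).trans (e ▸ norm_sub_le _ _)
    have h3 := ((H x - G x₀).le_opNorm y).trans
      (mul_le_mul_of_nonneg_right hx.le (norm_nonneg y))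
    linarith
  -- Lipschitz bound for the derivative of the metric
  obtain ⟨K, s, hs, hlip⟩ := hDG.exists_lipschitzOnWith
  -- One constant serves both as a Lipschitz constant for `DG` and as a bound for its norm.
  set K' : ℝ := max K (‖fderiv ℝ G x₀‖ + 1) with hK'
  have hbd : ∀ᶠ x in 𝓝 x₀, ‖fderiv ℝ G x‖ ≤ K' := by
    filter_upwards [hDG.continuousAt.norm.eventually (gt_mem_nhds (lt_add_one _))] with x hx
    exact hx.le.trans (le_max_right _ _)
  have hA : ∀ᶠ x in 𝓝 x₀, ‖fderiv ℝ φ x‖ ≤ 2 := by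
    have : ‖fderiv ℝ φ x₀‖ < 2 := by
      rw [h1]; exact ContinuousLinearMap.norm_id_le.trans_lt (by norm_num)
    filter_upwards [hDφ.continuousAt.norm.eventually (gt_mem_nhds this)] with x hx using hx.le
  have hGd : ∀ᶠ x in 𝓝 x₀, DifferentiableAt ℝ G x := by
    filter_upwards [hG.eventually (by simp)] with x hx using hx.differentiableAt (by norm_num)
  -- Three Koszul terms of size `8 * K' * δ`, halved by the factor `2` on the left, give `12 * K' *
  -- δ`; dividing by `c / 2` yields `24 * K' / c`.
  refine eventually_eq_id_of_norm_second_fderiv_le (C := 24 * K' / c) hφ h0 h1 ?_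
  filter_upwards [hHlow, hs, hφc.eventually hs, hφc.eventually hbd, hA, hGd, hφc.eventually hGd,
    hφ.eventually (by simp), hφc.eventually hsymm, hinv.eventually_nhds]
    with x hx1 hx2 hx3 hx4 hx5 hx6 hx7 hx8 hx9 hx10
  set δ := max ‖φ x - x‖ ‖fderiv ℝ φ x - ContinuousLinearMap.id ℝ E‖ with hδ
  have hδ0 : 0 ≤ δ := (norm_nonneg _).trans (le_max_left _ _)
  have hK0 : 0 ≤ K' := (norm_nonneg _).trans hx4
  have hS := norm_trilinear_sub_pullback_le (fderiv ℝ G x) (fderiv ℝ G (φ x)) (fderiv ℝ φ x)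
    (K := K') (δ := δ) ((hlip.norm_sub_le hx2 hx3).trans (by
      rw [norm_sub_rev x]
      exact mul_le_mul (le_max_left _ _) (le_max_left _ _) (norm_nonneg _) hK0)) hx4 hx5
    (by rw [norm_sub_rev]; exact le_max_right _ _)
  have hkos := koszul_second_fderiv hx6 hx7 hx8 hx9 hx10 (fun _ _ _ ↦ rfl)
  refine ContinuousLinearMap.opNorm_le_bound₂ _ (by positivity) fun u v ↦ ?_
  have hHb : ‖H x (fderiv ℝ (fderiv ℝ φ) x u v)‖ ≤ 12 * K' * δ * (‖u‖ * ‖v‖) := by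
    refine ContinuousLinearMap.opNorm_le_bound _ (by positivity) fun w ↦ ?_
    have e : H x (fderiv ℝ (fderiv ℝ φ) x u v) w
        = G (φ x) (fderiv ℝ (fderiv ℝ φ) x u v) (fderiv ℝ φ x w) := by simp [H]
    rw [e, Real.norm_eq_abs]
    have k := hkos u v w
    have s1 := abs_le.1 (hS u v w)
    have s2 := abs_le.1 (hS v u w)
    have s3 := abs_le.1 (hS w u v)
    rw [abs_le]
    constructor <;> nlinarith [s1.1, s1.2, s2.1, s2.2, s3.1, s3.2]
  have := (hx1 _).trans hHb
  rw [← mul_le_mul_iff_right₀ (half_pos hc)]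
  calc _ ≤ _ := this
    _ = _ := by field_simp; ring

/-! ### Exterior derivatives of one-forms. -/

/-- The exterior derivative of a one-form on a normed space, as a continuous bilinear form. -/
noncomputable def extDerivForm (a : E → E →L[ℝ] ℝ) (x : E) : E →L[ℝ] E →L[ℝ] ℝ :=
  fderiv ℝ a x - (fderiv ℝ a x).flip

theorem extDerivForm_apply (a : E → E →L[ℝ] ℝ) (x v w : E) :
    extDerivForm a x v w = fderiv ℝ a x v w - fderiv ℝ a x w v := by
  simp [extDerivForm]

theorem contDiffAt_extDerivForm {a : E → E →L[ℝ] ℝ} {x : E} {m n : WithTop ℕ∞}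
    (ha : ContDiffAt ℝ n a x) (hmn : m + 1 ≤ n) : ContDiffAt ℝ m (extDerivForm a) x := by
  have h := ha.fderiv_right hmn
  exact h.sub ((ContinuousLinearMap.flipₗᵢ ℝ E E ℝ).contDiff.contDiffAt.comp x h)

/-- The exterior derivative of `φ^* a = l a`. -/
theorem extDerivForm_pullback {a : E → E →L[ℝ] ℝ} {φ : E → E} {l : E → ℝ} {x : E}
    (ha : DifferentiableAt ℝ a x) (haφ : DifferentiableAt ℝ a (φ x)) (hφ : ContDiffAt ℝ 2 φ x)
    (hl : DifferentiableAt ℝ l x)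
    (h : ∀ᶠ y in 𝓝 x, ∀ v, a (φ y) (fderiv ℝ φ y v) = l y * a y v) (u v : E) :
    extDerivForm a (φ x) (fderiv ℝ φ x u) (fderiv ℝ φ x v)
      = l x * extDerivForm a x u v + fderiv ℝ l x u * a x v - fderiv ℝ l x v * a x u := by
  have hφ1 : HasFDerivAt φ (fderiv ℝ φ x) x := (hφ.differentiableAt (by norm_num)).hasFDerivAt
  have hφ2 : HasFDerivAt (fderiv ℝ φ) (fderiv ℝ (fderiv ℝ φ) x) x :=
    ((hφ.fderiv_right (m := 1) (by norm_num)).differentiableAt (by norm_num)).hasFDerivAt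
  have hc : HasFDerivAt (fun y ↦ a (φ y)) _ x := HasFDerivAt.comp (g := a) x haφ.hasFDerivAt hφ1
  have key : ∀ u v, fderiv ℝ a (φ x) (fderiv ℝ φ x u) (fderiv ℝ φ x v)
      + a (φ x) (fderiv ℝ (fderiv ℝ φ) x u v)
      = l x * fderiv ℝ a x u v + fderiv ℝ l x u * a x v := by
    intro u v
    have hL := hc.clm_apply (hφ2.clm_apply (hasFDerivAt_const v x))
    have hR := hl.hasFDerivAt.mul (ha.hasFDerivAt.clm_apply (hasFDerivAt_const v x))
    have := hL.congr_of_eventuallyEq (f₁ := fun y ↦ l y * a y v)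
      (by filter_upwards [h] with y hy using (hy v).symm)
    have := congrArg (fun L : E →L[ℝ] ℝ ↦ L u) (this.unique hR)
    simp at this
    linarith
  have h2 : fderiv ℝ (fderiv ℝ φ) x u v = fderiv ℝ (fderiv ℝ φ) x v u :=
    (hφ.isSymmSndFDerivAt (by simp)).eq u v
  rw [extDerivForm_apply, extDerivForm_apply]
  have e1 := key u v
  have e2 := key v u
  rw [h2] at e1
  linarith

/-- The exterior derivative of the product of a function and a one-form. -/
theorem extDerivForm_smul {a : E → E →L[ℝ] ℝ} {r : E → ℝ} {x : E}
    (ha : DifferentiableAt ℝ a x) (hr : DifferentiableAt ℝ r x) (u v : E) :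
    extDerivForm (fun y ↦ r y • a y) x u v
      = r x * extDerivForm a x u v + fderiv ℝ r x u * a x v - fderiv ℝ r x v * a x u := by
  have h := (hr.hasFDerivAt.smul ha.hasFDerivAt).fderiv
  have h' : fderiv ℝ (fun y ↦ r y • a y) x
    = r x • fderiv ℝ a x + (fderiv ℝ r x).smulRight (a x) := h
  rw [extDerivForm_apply, extDerivForm_apply, h']
  simp
  ring

/-! ### Frames of the kernel of a one-form. -/

/-- The projection onto the kernel of `α` along `ξ`, where `α ξ ≠ 0`. -/
noncomputable def kerProj (α : E →L[ℝ] ℝ) (ξ : E) : E →L[ℝ] E :=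
  ContinuousLinearMap.id ℝ E - (α ξ)⁻¹ • α.smulRight ξ

theorem kerProj_apply (α : E →L[ℝ] ℝ) (ξ v : E) : kerProj α ξ v = v - ((α ξ)⁻¹ * α v) • ξ := by
  simp [kerProj, smul_smul]

theorem apply_kerProj {α : E →L[ℝ] ℝ} {ξ : E} (h : α ξ ≠ 0) (v : E) : α (kerProj α ξ v) = 0 := by
  simp [kerProj_apply]
  field_simp
  simp

theorem kerProj_of_apply_eq_zero {α : E →L[ℝ] ℝ} (ξ : E) {v : E} (h : α v = 0) :
    kerProj α ξ v = v := by
  simp [kerProj_apply, h]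

theorem kerProj_self {α : E →L[ℝ] ℝ} {ξ : E} (h : α ξ ≠ 0) : kerProj α ξ ξ = 0 := by
  simp [kerProj_apply, h]

theorem contDiffAt_kerProj {a : E → E →L[ℝ] ℝ} {ξ : E → E} {x : E} {m : WithTop ℕ∞}
    (ha : ContDiffAt ℝ m a x) (hξ : ContDiffAt ℝ m ξ x) (h : a x (ξ x) ≠ 0) :
    ContDiffAt ℝ m (fun y ↦ kerProj (a y) (ξ y)) x := by
  unfold kerProj
  exact contDiffAt_const.sub (((ha.clm_apply hξ).inv h).smul (ha.smulRight hξ))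

/-- A basis of the kernel of a nonzero linear form, completed by a transverse vector `ξ`. -/
theorem exists_ker_frame [FiniteDimensional ℝ E] {α : E →L[ℝ] ℝ} (hα : α ≠ 0) :
    ∃ (N : ℕ) (ξ : E) (e : Fin N → E) (c : Fin N → E →L[ℝ] ℝ), N + 1 = Module.finrank ℝ E ∧
      α ξ = 1 ∧ (∀ i, α (e i) = 0) ∧ LinearIndependent ℝ e ∧
      ∀ v, v = ∑ i, c i v • e i + α v • ξ := by
  obtain ⟨ξ', hξ'⟩ : ∃ v, α v ≠ 0 := by
    by_contra! h; exact hα (ContinuousLinearMap.ext h)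
  let ξ := (α ξ')⁻¹ • ξ'
  have hξ : α ξ = 1 := by simp [ξ, hξ']
  let K := LinearMap.ker α.toLinearMap
  let b := Module.finBasis ℝ K
  have hmem : ∀ v, kerProj α ξ v ∈ K := fun v ↦ apply_kerProj (by simp [hξ]) v
  let p : E →ₗ[ℝ] K := (kerProj α ξ).toLinearMap.codRestrict K hmem
  refine ⟨_, ξ, fun i ↦ b i, fun i ↦ LinearMap.toContinuousLinearMap (b.coord i ∘ₗ p), ?_, hξ,
    fun i ↦ (b i).2, ?_, fun v ↦ ?_⟩
  · have hr : LinearMap.range α.toLinearMap = ⊤ :=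
      LinearMap.range_eq_top.2 (LinearMap.surjective fun h ↦ hα (by ext v; simpa using congr($h v)))
    have := LinearMap.finrank_range_add_finrank_ker α.toLinearMap
    rw [hr, finrank_top, Module.finrank_self] at this
    rw [← this, add_comm]
  · exact b.linearIndependent.map' K.subtype K.ker_subtype
  · have := congrArg Subtype.val (b.sum_repr (p v))
    simp only [Submodule.coe_sum, Submodule.coe_smul] at this
    have e : (p v : E) = v - α v • ξ := by simp [p, kerProj_apply, hξ]
    rw [e] at this
    exact (sub_eq_iff_eq_add.1 this.symm)

/-- Expansion of a vector of `ker α'` in the frame obtained by projecting a frame of `ker α`. -/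
theorem eq_sum_kerProj {N : ℕ} {α α' : E →L[ℝ] ℝ} {ξ : E} {e : Fin N → E}
    {c : Fin N → E →L[ℝ] ℝ} (hc : ∀ v, v = ∑ i, c i v • e i + α v • ξ) (hξ : α' ξ ≠ 0) {v : E}
    (hv : α' v = 0) : v = ∑ i, c i v • kerProj α' ξ (e i) := by
  have := congrArg (kerProj α' ξ) (hc v)
  rw [kerProj_of_apply_eq_zero ξ hv] at this
  simpa [kerProj_self hξ] using this

/-- A family of bilinear forms which is smooth on smooth sections of `ker a` agrees on `ker a` with
a smooth family of bilinear forms. -/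
theorem exists_smooth_bilin [FiniteDimensional ℝ E] {a : E → E →L[ℝ] ℝ}
    {h : E → LinearMap.BilinForm ℝ E} {V : Set E} (hV : IsOpen V) {x₀ : E} (hx₀ : x₀ ∈ V)
    (ha : ContDiffOn ℝ ∞ a V) (ha0 : a x₀ ≠ 0)
    (hsm : ∀ V' ⊆ V, IsOpen V' → ∀ X Y : E → E, ContDiffOn ℝ ∞ X V' → ContDiffOn ℝ ∞ Y V' →
      (∀ x ∈ V', a x (X x) = 0) → (∀ x ∈ V', a x (Y x) = 0) →
      ContDiffOn ℝ ∞ (fun x ↦ h x (X x) (Y x)) V') :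
    ∃ h' : E → E →L[ℝ] E →L[ℝ] ℝ, ContDiffAt ℝ ∞ h' x₀ ∧
      ∀ᶠ x in 𝓝 x₀, ∀ v w, a x v = 0 → a x w = 0 → h' x v w = h x v w := by
  obtain ⟨N, ξ, e, c, -, hξ, -, -, hc⟩ := exists_ker_frame ha0
  let V' := V ∩ (fun x ↦ a x ξ) ⁻¹' {0}ᶜ
  have hV' : IsOpen V' :=
    (ha.continuousOn.clm_apply continuousOn_const).isOpen_inter_preimage hV isOpen_compl_singleton
  have hx₀' : x₀ ∈ V' := ⟨hx₀, by simp [hξ]⟩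
  have hP : ∀ i, ContDiffOn ℝ ∞ (fun x ↦ kerProj (a x) ξ (e i)) V' := by
    intro i x hx
    exact ((contDiffAt_kerProj (ha.contDiffAt (hV.mem_nhds hx.1)) contDiffAt_const
      hx.2).clm_apply contDiffAt_const).contDiffWithinAt
  have hker : ∀ i, ∀ x ∈ V', a x (kerProj (a x) ξ (e i)) = 0 := fun i x hx ↦ apply_kerProj hx.2 _
  -- The coefficients are values of `h` on smooth sections of `ker a`, hence smooth. The constant
  -- forms `c i` still read off coordinates in the moving frame, because projecting along `ξ`
  -- removes only the `ξ`-component.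
  refine ⟨fun x ↦ ∑ i, ∑ j, h x (kerProj (a x) ξ (e i)) (kerProj (a x) ξ (e j)) •
    (c i).smulRight (c j), ?_, ?_⟩
  · refine ContDiffAt.sum fun i _ ↦ ContDiffAt.sum fun j _ ↦ ?_
    exact ((hsm V' Set.inter_subset_left hV' _ _ (hP i) (hP j) (hker i) (hker j)).contDiffAt
      (hV'.mem_nhds hx₀')).smul contDiffAt_const
  · filter_upwards [hV'.mem_nhds hx₀'] with x hx v w hv hw
    conv_rhs => rw [eq_sum_kerProj hc hx.2 hv, eq_sum_kerProj hc hx.2 hw]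
    simp only [map_sum, LinearMap.sum_apply, map_smul, LinearMap.smul_apply,
      sum_apply, smul_apply,
      ContinuousLinearMap.smulRight_apply, smul_eq_mul]
    rw [Finset.sum_comm]
    refine Finset.sum_congr rfl fun i _ ↦ ?_
    rw [Finset.mul_sum]
    exact Finset.sum_congr rfl fun j _ ↦ by ring

/-! ### Gram determinants and the normalisation of a contact form. -/

/-- The Gram matrix of a bilinear form which is nondegenerate on the span of a linearly independent
family is invertible. -/
theorem det_gram_ne_zero {N : ℕ} {e : Fin N → E} (he : LinearIndependent ℝ e)
    (B : E →L[ℝ] E →L[ℝ] ℝ)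
    (hB : ∀ v ∈ Submodule.span ℝ (Set.range e), (∀ i, B v (e i) = 0) → v = 0) :
    (Matrix.of fun i j ↦ B (e i) (e j)).det ≠ 0 := by
  intro hdet
  obtain ⟨y, hy, hy0⟩ := Matrix.exists_vecMul_eq_zero_iff.2 hdet
  refine hy (funext fun i ↦ ?_)
  refine Fintype.linearIndependent_iff.1 he y (hB _ ?_ fun j ↦ ?_) i
  · exact Submodule.sum_mem _ fun i _ ↦ Submodule.smul_mem _ _ (Submodule.subset_span ⟨i, rfl⟩)
  · simpa [Matrix.vecMul, dotProduct] using congrFun hy0 j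

/-- Change of Gram matrices: if `A` maps the family `X` into the span of `Y` with matrix `T`. -/
theorem gram_pullback {N : ℕ} {X Y : Fin N → E} (A : E →L[ℝ] E) (T : Matrix (Fin N) (Fin N) ℝ)
    (hA : ∀ j, A (X j) = ∑ i, T i j • Y i) (B : E →L[ℝ] E →L[ℝ] ℝ) :
    (Matrix.of fun i j ↦ B (A (X i)) (A (X j)))
      = T.transpose * (Matrix.of fun i j ↦ B (Y i) (Y j)) * T := by
  ext i j
  simp only [Matrix.of_apply, hA, map_sum, map_smul, sum_apply,
    smul_apply, Matrix.mul_apply, Matrix.transpose_apply, smul_eq_mul]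
  exact Finset.sum_congr rfl fun k _ ↦ mul_comm _ _

theorem contDiffAt_det {N : ℕ} {W : E → Matrix (Fin N) (Fin N) ℝ} {x : E} {m : WithTop ℕ∞}
    (hW : ∀ i j, ContDiffAt ℝ m (fun y ↦ W y i j) x) : ContDiffAt ℝ m (fun y ↦ (W y).det) x := by
  simp only [Matrix.det_apply']
  exact ContDiffAt.sum fun σ _ ↦ contDiffAt_const.mul (contDiffAt_prod fun i _ ↦ hW _ _)

/-- A contact form with a metric on its kernel has a normalising factor `r`, which transforms by
`|l|` under maps pulling back `a` to `l a` and preserving the metric. -/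
theorem exists_normalization [FiniteDimensional ℝ E] (hdim : 2 ≤ Module.finrank ℝ E)
    {a : E → E →L[ℝ] ℝ} {h : E → E →L[ℝ] E →L[ℝ] ℝ} {x₀ : E}
    (ha : ContDiffAt ℝ 4 a x₀) (hh : ContDiffAt ℝ 4 h x₀) (ha0 : a x₀ ≠ 0)
    (hcontact : ∀ v, a x₀ v = 0 → (∀ w, a x₀ w = 0 → extDerivForm a x₀ v w = 0) → v = 0)
    (hnd : ∀ v, a x₀ v = 0 → (∀ w, a x₀ w = 0 → h x₀ v w = 0) → v = 0) :
    ∃ r : E → ℝ, ContDiffAt ℝ 3 r x₀ ∧ (∀ᶠ x in 𝓝 x₀, 0 < r x) ∧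
      ∃ s ∈ 𝓝 x₀, ∀ x ∈ s, ∀ y ∈ s, ∀ (A : E →L[ℝ] E) (l : ℝ), (∀ v, a x v = 0 → a y (A v) = 0) →
        (∀ v w, a x v = 0 → a x w = 0 → h y (A v) (A w) = h x v w) →
        (∀ v w, a x v = 0 → a x w = 0 →
          extDerivForm a y (A v) (A w) = l * extDerivForm a x v w) →
        |l * r y| = r x := by
  obtain ⟨N, ξ, e, c, hN, hξ, he, hli, hc⟩ := exists_ker_frame ha0
  -- This allows the root of order `2 * N` taken below.
  have hN0 : N ≠ 0 := by omega
  let X : E → Fin N → E := fun x i ↦ kerProj (a x) ξ (e i)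
  have hX0 : ∀ i, X x₀ i = e i := fun i ↦ kerProj_of_apply_eq_zero ξ (he i)
  have hX : ∀ i, ContDiffAt ℝ 4 (fun x ↦ X x i) x₀ := fun i ↦
    (contDiffAt_kerProj ha contDiffAt_const (by simp [hξ])).clm_apply contDiffAt_const
  let gram : (E → E →L[ℝ] E →L[ℝ] ℝ) → E → Matrix (Fin N) (Fin N) ℝ := fun B x ↦
    Matrix.of fun i j ↦ B x (X x i) (X x j)
  have hgram : ∀ B : E → E →L[ℝ] E →L[ℝ] ℝ, ContDiffAt ℝ 3 B x₀ →
      ContDiffAt ℝ 3 (fun x ↦ (gram B x).det) x₀ := fun B hB ↦ contDiffAt_det fun i j ↦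
    (hB.clm_apply ((hX i).of_le (by norm_num))).clm_apply ((hX j).of_le (by norm_num))
  have hspan : ∀ v ∈ Submodule.span ℝ (Set.range e), a x₀ v = 0 := by
    intro v hv
    have : Submodule.span ℝ (Set.range e) ≤ LinearMap.ker (a x₀).toLinearMap :=
      Submodule.span_le.2 (by rintro _ ⟨i, rfl⟩; exact he i)
    exact this hv
  have hgram0 : ∀ B : E → E →L[ℝ] E →L[ℝ] ℝ,
      (∀ v, a x₀ v = 0 → (∀ w, a x₀ w = 0 → B x₀ v w = 0) → v = 0) → (gram B x₀).det ≠ 0 := by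
    intro B hB
    simp only [gram, hX0]
    refine det_gram_ne_zero hli _ fun v hv hve ↦ hB v (hspan v hv) fun w hw ↦ ?_
    have := hc w
    rw [hw, zero_smul, add_zero] at this
    rw [this]
    simp [hve]
  have hW := hgram _ (contDiffAt_extDerivForm ha (m := 3) (by norm_num))
  have hH := hgram h (hh.of_le (by norm_num))
  have hW0 := hgram0 _ hcontact
  have hH0 := hgram0 _ hnd
  -- Squaring makes the quotient positive whatever the signs of the determinants, so real powers of
  -- it are smooth.
  let q : E → ℝ := fun x ↦ ((gram (extDerivForm a) x).det / (gram h x).det) ^ 2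
  have hq : ContDiffAt ℝ 3 q x₀ := (hW.div hH hH0).pow 2
  have hq0 : q x₀ ≠ 0 := pow_ne_zero _ (div_ne_zero hW0 hH0)
  let s : Set E := {x | a x ξ ≠ 0 ∧ (gram (extDerivForm a) x).det ≠ 0 ∧ (gram h x).det ≠ 0}
  have hs : s ∈ 𝓝 x₀ := by
    have h1 : ∀ᶠ x in 𝓝 x₀, a x ξ ≠ 0 :=
      (ha.continuousAt.clm_apply continuousAt_const).eventually_ne (by simp [hξ])
    filter_upwards [h1, hW.continuousAt.eventually_ne hW0, hH.continuousAt.eventually_ne hH0]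
      with x h1 h2 h3 using ⟨h1, h2, h3⟩
  have hqpos : ∀ x ∈ s, 0 < q x := fun x hx ↦ by
    have := div_ne_zero hx.2.1 hx.2.2
    positivity
  -- Since `q` gets multiplied by `l ^ (2 * N)`, this exponent makes `r` transform by `|l|⁻¹`.
  let r : E → ℝ := fun x ↦ q x ^ (-((2 * N : ℕ) : ℝ)⁻¹)
  have hrpos : ∀ x ∈ s, 0 < r x := fun x hx ↦ Real.rpow_pos_of_pos (hqpos x hx) _
  have hrq : ∀ x ∈ s, r x ^ (2 * N) * q x = 1 := by
    intro x hx
    have h2N : 2 * N ≠ 0 := by omega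
    have : r x ^ (2 * N) = (q x)⁻¹ := by
      simp only [r]
      rw [Real.rpow_neg (hqpos x hx).le, inv_pow, Real.rpow_inv_natCast_pow (hqpos x hx).le h2N]
    rw [this, inv_mul_cancel₀ (hqpos x hx).ne']
  refine ⟨r, hq.rpow_const_of_ne hq0, Filter.mem_of_superset hs hrpos, s, hs, ?_⟩
  intro x hx y hy A l hA1 hA2 hA3
  have hXk : ∀ i, a x (X x i) = 0 := fun i ↦ apply_kerProj hx.1 _
  -- The matrix of `A` between the projected frames at `x` and `y`. Both Gram determinants acquire
  -- the factor `T.det ^ 2`, which cancels in `q`; nondegeneracy of `h` at `x` forces `T.det ≠ 0`.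
  let T : Matrix (Fin N) (Fin N) ℝ := Matrix.of fun i j ↦ c i (A (X x j))
  have hT : ∀ j, A (X x j) = ∑ i, T i j • X y i := fun j ↦
    eq_sum_kerProj hc hy.1 (hA1 _ (hXk j))
  have g1 : (gram h x).det = T.det ^ 2 * (gram h y).det := by
    have := gram_pullback A T hT (h y)
    simp only [fun i j ↦ hA2 _ _ (hXk i) (hXk j)] at this
    have := congrArg Matrix.det this
    rw [Matrix.det_mul, Matrix.det_mul, Matrix.det_transpose] at this
    rw [show (gram h x).det = _ from this]
    ring
  have g2 : l ^ N * (gram (extDerivForm a) x).det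
      = T.det ^ 2 * (gram (extDerivForm a) y).det := by
    have := gram_pullback A T hT (extDerivForm a y)
    simp only [fun i j ↦ hA3 _ _ (hXk i) (hXk j)] at this
    have := congrArg Matrix.det this
    rw [Matrix.det_mul, Matrix.det_mul, Matrix.det_transpose] at this
    have e : (Matrix.of fun i j ↦ l * extDerivForm a x (X x i) (X x j))
      = l • gram (extDerivForm a) x := rfl
    rw [e, Matrix.det_smul, Fintype.card_fin] at this
    rw [this]
    ring
  have hT0 : T.det ≠ 0 := by
    intro h0; rw [h0] at g1; exact hx.2.2 (by simpa using g1)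
  have hqxy : q y = (l ^ 2) ^ N * q x := by
    have hy3 := hy.2.2
    have : (gram (extDerivForm a) y).det / (gram h y).det
        = l ^ N * ((gram (extDerivForm a) x).det / (gram h x).det) := by
      rw [g1, ← mul_div_assoc, g2]
      field_simp
    simp only [q]
    rw [this]
    ring
  have h1 := hrq x hx
  have h2 := hrq y hy
  rw [hqxy] at h2
  have h3 : (l * r y) ^ (2 * N) = r x ^ (2 * N) := by
    have := (hqpos x hx).ne'
    apply mul_right_cancel₀ this
    rw [h1, ← h2]
    ring
  have h4 : |l * r y| ^ (2 * N) = r x ^ (2 * N) := by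
    rw [← abs_pow, h3, abs_of_pos (pow_pos (hrpos x hx) _)]
  exact (pow_left_inj₀ (abs_nonneg _) (hrpos x hx).le (by omega)).1 h4

/-! ### The Reeb field and rigidity of contact metric germs. -/

/-- The bilinear form `da + a ⊗ a`, nondegenerate when `a` is a contact form. -/
noncomputable def contactBilin (a : E → E →L[ℝ] ℝ) (x : E) : E →L[ℝ] E →L[ℝ] ℝ :=
  extDerivForm a x + (a x).smulRight (a x)

theorem contactBilin_apply (a : E → E →L[ℝ] ℝ) (x v w : E) :
    contactBilin a x v w = extDerivForm a x v w + a x v * a x w := by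
  simp [contactBilin]

/-- The Reeb vector field of a contact form, characterised by `(da + a ⊗ a)(ξ, ·) = a`. -/
theorem exists_reeb [FiniteDimensional ℝ E] {a : E → E →L[ℝ] ℝ} {x₀ : E}
    (ha : ContDiffAt ℝ 3 a x₀) (ha0 : a x₀ ≠ 0)
    (hcontact : ∀ v, a x₀ v = 0 → (∀ w, a x₀ w = 0 → extDerivForm a x₀ v w = 0) → v = 0) :
    ∃ ξ : E → E, ContDiffAt ℝ 2 ξ x₀ ∧ (∀ᶠ x in 𝓝 x₀, a x (ξ x) = 1) ∧
      (∀ᶠ x in 𝓝 x₀, ∀ v, contactBilin a x v = a x ↔ v = ξ x) := by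
  have : CompleteSpace E := FiniteDimensional.complete ℝ E
  have hβ : ContDiffAt ℝ 2 (contactBilin a) x₀ := by
    have ha' : ContDiffAt ℝ 2 a x₀ := ha.of_le (by norm_num)
    exact (contDiffAt_extDerivForm ha (by norm_num)).add (ha'.smulRight ha')
  have hself : ∀ x v, extDerivForm a x v v = 0 := fun x v ↦ by simp [extDerivForm_apply]
  have hinj : Function.Injective (contactBilin a x₀).toLinearMap := by
    refine LinearMap.ker_eq_bot.1 (LinearMap.ker_eq_bot'.2 fun v hv ↦ ?_)
    have hv' : ∀ w, extDerivForm a x₀ v w + a x₀ v * a x₀ w = 0 := fun w ↦ by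
      rw [← contactBilin_apply]; exact congr($hv w)
    -- Testing on `v` itself kills `da` and leaves `a(v)² = 0`.
    have h1 := hv' v
    rw [hself, zero_add, mul_self_eq_zero] at h1
    exact hcontact v h1 fun w _ ↦ by simpa [h1] using hv' w
  have hfr : Module.finrank ℝ E = Module.finrank ℝ (E →L[ℝ] ℝ) := by
    rw [← LinearEquiv.finrank_eq (LinearMap.toContinuousLinearMap (𝕜 := ℝ) (E := E) (F' := ℝ))]
    exact Subspace.dual_finrank_eq.symm
  let ε : E ≃L[ℝ] (E →L[ℝ] ℝ) :=
    (LinearEquiv.ofInjectiveOfFinrankEq _ hinj hfr).toContinuousLinearEquiv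
  have hε : (ε : E →L[ℝ] E →L[ℝ] ℝ) = contactBilin a x₀ := by ext; rfl
  let ξ : E → E := fun x ↦ ContinuousLinearMap.inverse (contactBilin a x) (a x)
  have hξ : ContDiffAt ℝ 2 ξ x₀ := by
    have hinv : ContDiffAt ℝ 2 ContinuousLinearMap.inverse (contactBilin a x₀) := by
      rw [← hε]; exact contDiffAt_map_inverse ε
    have hc : ContDiffAt ℝ 2 (fun x ↦ (contactBilin a x).inverse) x₀ :=
      ContDiffAt.comp (g := ContinuousLinearMap.inverse) x₀ hinv hβ
    exact hc.clm_apply (ha.of_le (by norm_num))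
  have hiff : ∀ᶠ x in 𝓝 x₀, ∀ v, contactBilin a x v = a x ↔ v = ξ x := by
    have := hβ.continuousAt.eventually (hε ▸ ε.nhds)
    filter_upwards [this] with x ⟨ε', hε'⟩ v
    simp only [ξ]
    rw [← hε', ContinuousLinearMap.inverse_equiv]
    exact ε'.eq_symm_apply.symm
  -- Evaluating the defining equation at `ξ` shows that `a(ξ)` is `0` or `1`. At `x₀` the value `0`
  -- would force `ξ = 0` and then `a = 0`; continuity excludes it nearby.
  have hsq : ∀ᶠ x in 𝓝 x₀, a x (ξ x) * a x (ξ x) = a x (ξ x) := by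
    filter_upwards [hiff] with x hx
    have := congr($((hx _).2 rfl) (ξ x))
    rwa [contactBilin_apply, hself, zero_add] at this
  have h0 : a x₀ (ξ x₀) ≠ 0 := by
    intro h
    have h2 := (hiff.self_of_nhds _).2 rfl
    have h3 : ∀ w, extDerivForm a x₀ (ξ x₀) w = a x₀ w := fun w ↦ by
      have := congr($h2 w)
      rwa [contactBilin_apply, h, zero_mul, add_zero] at this
    have h4 := hcontact _ h fun w hw ↦ by rw [h3, hw]
    refine ha0 (ContinuousLinearMap.ext fun w ↦ ?_)
    rw [← h3, h4]
    simp
  refine ⟨ξ, hξ, ?_, hiff⟩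
  filter_upwards [hsq, ((ha.continuousAt.clm_apply hξ.continuousAt)).eventually_ne h0]
    with x hx1 hx2
  exact mul_right_cancel₀ hx2 (by rw [hx1, one_mul])

/-- A linear map between the contact hyperplanes which preserves the contact form up to the factor
`1` and its exterior derivative intertwines the Reeb fields. -/
theorem eq_of_contactBilin_pullback {a : E → E →L[ℝ] ℝ} {x y ξ η : E} {A : E →L[ℝ] E}
    (hA : Function.Surjective A) (hξ : contactBilin a x ξ = a x)
    (hη : ∀ v, contactBilin a y v = a y ↔ v = η) (ha : ∀ v, a y (A v) = a x v)
    (hda : ∀ v w, extDerivForm a y (A v) (A w) = extDerivForm a x v w) : A ξ = η := by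
  refine (hη _).1 (ContinuousLinearMap.ext fun w ↦ ?_)
  obtain ⟨w, rfl⟩ := hA w
  rw [contactBilin_apply, hda, ha, ha, ← contactBilin_apply, hξ]

theorem eventually_surjective_fderiv [CompleteSpace E] {φ : E → E} {x₀ : E}
    (hφ : ContDiffAt ℝ 2 φ x₀) (h1 : fderiv ℝ φ x₀ = ContinuousLinearMap.id ℝ E) :
    ∀ᶠ x in 𝓝 x₀, Function.Surjective (fderiv ℝ φ x) := by
  have hc : ContinuousAt (fderiv ℝ φ) x₀ :=
    (hφ.fderiv_right (m := 1) (by norm_num)).continuousAt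
  have hn := (ContinuousLinearEquiv.refl ℝ E).nhds
  rw [ContinuousLinearEquiv.coe_refl, ← h1] at hn
  have := hc.eventually hn
  filter_upwards [this] with x ⟨ε, hε⟩
  rw [← hε]
  exact ε.surjective

/-- Rigidity for strict contact transformations: they preserve the contact form itself. -/
theorem eventually_eq_id_of_preserves_form [FiniteDimensional ℝ E]
    {a : E → E →L[ℝ] ℝ} {h : E → E →L[ℝ] E →L[ℝ] ℝ} {φ : E → E} {x₀ : E}
    (ha : ContDiffAt ℝ 3 a x₀) (hh : ContDiffAt ℝ 2 h x₀) (hφ : ContDiffAt ℝ 2 φ x₀)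
    (h0 : φ x₀ = x₀) (h1 : fderiv ℝ φ x₀ = ContinuousLinearMap.id ℝ E) (ha0 : a x₀ ≠ 0)
    (hcontact : ∀ v, a x₀ v = 0 → (∀ w, a x₀ w = 0 → extDerivForm a x₀ v w = 0) → v = 0)
    (hnd : ∀ v, a x₀ v = 0 → (∀ w, a x₀ w = 0 → h x₀ v w = 0) → v = 0)
    (hsymm : ∀ᶠ x in 𝓝 x₀, ∀ v w, a x v = 0 → a x w = 0 → h x v w = h x w v)
    (hinva : ∀ᶠ x in 𝓝 x₀, ∀ v, a (φ x) (fderiv ℝ φ x v) = a x v)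
    (hinvh : ∀ᶠ x in 𝓝 x₀, ∀ v w, a x v = 0 → a x w = 0 →
      h (φ x) (fderiv ℝ φ x v) (fderiv ℝ φ x w) = h x v w) :
    ∀ᶠ x in 𝓝 x₀, φ x = x := by
  have : CompleteSpace E := FiniteDimensional.complete ℝ E
  have hφc : Tendsto φ (𝓝 x₀) (𝓝 x₀) := by simpa [ContinuousAt, h0] using hφ.continuousAt
  obtain ⟨ξ, hξ, haξ, hβξ⟩ := exists_reeb ha ha0 hcontact
  have ha2 : ContDiffAt ℝ 2 a x₀ := ha.of_le (by norm_num)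
  have had : ∀ᶠ x in 𝓝 x₀, DifferentiableAt ℝ a x := by
    filter_upwards [ha.eventually (by simp)] with x hx using hx.differentiableAt (by norm_num)
  have hda : ∀ᶠ x in 𝓝 x₀, ∀ v w, extDerivForm a (φ x) (fderiv ℝ φ x v) (fderiv ℝ φ x w)
      = extDerivForm a x v w := by
    filter_upwards [had, hφc.eventually had, hφ.eventually (by simp), hinva.eventually_nhds]
      with x hx1 hx2 hx3 hx4 v w
    simpa using extDerivForm_pullback (l := fun _ ↦ 1) hx1 hx2 hx3 (by fun_prop)
      (by simpa using hx4) v w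
  have hφξ : ∀ᶠ x in 𝓝 x₀, fderiv ℝ φ x (ξ x) = ξ (φ x) := by
    filter_upwards [eventually_surjective_fderiv hφ h1, hβξ, hφc.eventually hβξ, hinva, hda]
      with x hx1 hx2 hx3 hx4 hx5
    exact eq_of_contactBilin_pullback hx1 ((hx2 _).2 rfl) hx3 hx4 hx5
  let p : E → E →L[ℝ] E := fun x ↦ kerProj (a x) (ξ x)
  have hp : ContDiffAt ℝ 2 p x₀ :=
    contDiffAt_kerProj ha2 hξ (by rw [haξ.self_of_nhds]; exact one_ne_zero)
  have hpa : ∀ᶠ x in 𝓝 x₀, ∀ v, a x (p x v) = 0 := by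
    filter_upwards [haξ] with x hx v using apply_kerProj (by simp [hx]) v
  have hpφ : ∀ᶠ x in 𝓝 x₀, ∀ v, p (φ x) (fderiv ℝ φ x v) = fderiv ℝ φ x (p x v) := by
    filter_upwards [haξ, hφc.eventually haξ, hinva, hφξ] with x hx1 hx2 hx3 hx4 v
    simp only [p, kerProj_apply, hx1, hx2, hx3, map_sub, map_smul, hx4]
  -- The metric equal to `h` on `ker a` for which the Reeb field has square `1` and is orthogonal to
  -- `ker a`.
  let G : E → E →L[ℝ] E →L[ℝ] ℝ := fun x ↦
    (ContinuousLinearMap.compL ℝ E E ℝ).flip (p x) ∘L (h x ∘L p x) + (a x).smulRight (a x)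
  have hG : ∀ x v w, G x v w = h x (p x v) (p x w) + a x v * a x w := by
    intro x v w; simp [G]
  refine eventually_eq_id_of_preserves_metric (G := G) ?_ hφ h0 h1 ?_ ?_ ?_
  · have hc : ContDiffAt ℝ 2 (fun x ↦ (ContinuousLinearMap.compL ℝ E E ℝ).flip (p x)) x₀ :=
      (ContinuousLinearMap.compL ℝ E E ℝ).flip.contDiff.contDiffAt.comp x₀ hp
    exact (hc.clm_comp (hh.clm_comp hp)).add (ha2.smulRight ha2)
  · filter_upwards [hsymm, hpa] with x hx1 hx2 v w
    rw [hG, hG, hx1 _ _ (hx2 v) (hx2 w), mul_comm (a x v)]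
  · intro v hv
    have hv' : ∀ w, h x₀ (p x₀ v) (p x₀ w) + a x₀ v * a x₀ w = 0 := fun w ↦ by
      rw [← hG, hv]; rfl
    have e1 := haξ.self_of_nhds
    have e2 : p x₀ (ξ x₀) = 0 := kerProj_self (by simp [e1])
    have e3 := hv' (ξ x₀)
    rw [e2, e1, map_zero, zero_add, mul_one] at e3
    have e4 : p x₀ v = v := kerProj_of_apply_eq_zero _ e3
    refine hnd v e3 fun w hw ↦ ?_
    have := hv' w
    rwa [e4, show p x₀ w = w from kerProj_of_apply_eq_zero _ hw, e3, zero_mul, add_zero] at this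
  · filter_upwards [hinva, hinvh, hpφ, hpa] with x hx1 hx2 hx3 hx4 v w
    rw [hG, hG, hx3, hx3, hx2 _ _ (hx4 v) (hx4 w), hx1, hx1]

/-- Local rigidity: a local diffeomorphism preserving the kernel of a contact form and a metric on
it, and having the one-jet of the identity at a point, is the identity near that point. -/
theorem eventually_eq_id_of_preserves_kernel [FiniteDimensional ℝ E]
    (hdim : 2 ≤ Module.finrank ℝ E)
    {a : E → E →L[ℝ] ℝ} {h : E → E →L[ℝ] E →L[ℝ] ℝ} {φ : E → E} {x₀ : E}
    (ha : ContDiffAt ℝ 4 a x₀) (hh : ContDiffAt ℝ 4 h x₀) (hφ : ContDiffAt ℝ 2 φ x₀)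
    (h0 : φ x₀ = x₀) (h1 : fderiv ℝ φ x₀ = ContinuousLinearMap.id ℝ E) (ha0 : a x₀ ≠ 0)
    (hcontact : ∀ v, a x₀ v = 0 → (∀ w, a x₀ w = 0 → extDerivForm a x₀ v w = 0) → v = 0)
    (hnd : ∀ v, a x₀ v = 0 → (∀ w, a x₀ w = 0 → h x₀ v w = 0) → v = 0)
    (hsymm : ∀ᶠ x in 𝓝 x₀, ∀ v w, a x v = 0 → a x w = 0 → h x v w = h x w v)
    (hinva : ∀ᶠ x in 𝓝 x₀, ∀ v, a x v = 0 → a (φ x) (fderiv ℝ φ x v) = 0)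
    (hinvh : ∀ᶠ x in 𝓝 x₀, ∀ v w, a x v = 0 → a x w = 0 →
      h (φ x) (fderiv ℝ φ x v) (fderiv ℝ φ x w) = h x v w) :
    ∀ᶠ x in 𝓝 x₀, φ x = x := by
  have hφc : Tendsto φ (𝓝 x₀) (𝓝 x₀) := by simpa [ContinuousAt, h0] using hφ.continuousAt
  obtain ⟨N, ξ, e, c, -, hξ, -⟩ := exists_ker_frame ha0
  obtain ⟨r, hr, hrpos, s, hs, hrs⟩ := exists_normalization hdim ha hh ha0 hcontact hnd
  have had : ∀ᶠ x in 𝓝 x₀, DifferentiableAt ℝ a x := by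
    filter_upwards [ha.eventually (by simp)] with x hx using hx.differentiableAt (by norm_num)
  have haξ : ∀ᶠ x in 𝓝 x₀, a x ξ ≠ 0 :=
    (ha.continuousAt.clm_apply continuousAt_const).eventually_ne (by simp [hξ])
  -- the conformal factor
  let l : E → ℝ := fun x ↦ a (φ x) (fderiv ℝ φ x ξ) / a x ξ
  have hl : ContDiffAt ℝ 1 l x₀ := by
    have e1 : ContDiffAt ℝ 1 (fun x ↦ a (φ x)) x₀ := ContDiffAt.comp x₀
      (by rw [h0]; exact ha.of_le (by norm_num)) (hφ.of_le (by norm_num))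
    have e2 : ContDiffAt ℝ 1 (fderiv ℝ φ) x₀ := hφ.fderiv_right (by norm_num)
    have e3 : ContDiffAt ℝ 1 a x₀ := ha.of_le (by norm_num)
    exact (e1.clm_apply (e2.clm_apply contDiffAt_const)).div (e3.clm_apply contDiffAt_const)
      haξ.self_of_nhds
  have hl0 : l x₀ = 1 := by simp [l, h0, h1, hξ]
  have hal : ∀ᶠ x in 𝓝 x₀, ∀ v, a (φ x) (fderiv ℝ φ x v) = l x * a x v := by
    filter_upwards [haξ, hinva] with x hx1 hx2 v
    have := hx2 _ (apply_kerProj hx1 v)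
    rw [kerProj_apply, map_sub, map_sub, map_smul, map_smul, smul_eq_mul, sub_eq_zero] at this
    rw [this]
    simp only [l]
    field_simp
  have hda : ∀ᶠ x in 𝓝 x₀, ∀ v w, a x v = 0 → a x w = 0 →
      extDerivForm a (φ x) (fderiv ℝ φ x v) (fderiv ℝ φ x w) = l x * extDerivForm a x v w := by
    filter_upwards [had, hφc.eventually had, hφ.eventually (by simp),
      hl.eventually (by simp), hal.eventually_nhds] with x hx1 hx2 hx3 hx4 hx5 v w hv hw
    rw [extDerivForm_pullback hx1 hx2 hx3 (hx4.differentiableAt (by norm_num)) hx5, hv, hw]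
    ring
  have hlr : ∀ᶠ x in 𝓝 x₀, l x * r (φ x) = r x := by
    -- Continuity from `l x₀ = 1` removes the sign ambiguity left by the normalisation.
    have hlpos : ∀ᶠ x in 𝓝 x₀, 0 < l x :=
      hl.continuousAt.eventually (lt_mem_nhds (by rw [hl0]; exact one_pos))
    filter_upwards [hs, hφc.eventually hs, hinva, hinvh, hda, hlpos, hφc.eventually hrpos]
      with x hx1 hx2 hx3 hx4 hx5 hx6 hx7
    rw [← hrs x hx1 _ hx2 _ _ hx3 hx4 hx5, abs_of_pos (mul_pos hx6 hx7)]
  have hker : ∀ᶠ x in 𝓝 x₀, ∀ v, r x • a x v = 0 ↔ a x v = 0 := by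
    filter_upwards [hrpos] with x hx v
    simp [hx.ne']
  have hr0 := hrpos.self_of_nhds
  have hker0 : ∀ v, (r x₀ • a x₀) v = 0 ↔ a x₀ v = 0 := hker.self_of_nhds
  -- Derivative count: `a` of class `C⁴` gives `da`, hence `r` and `r a`, of class `C³`; then the
  -- Reeb field and the full metric are `C²`.
  refine eventually_eq_id_of_preserves_form (a := fun x ↦ r x • a x) (h := h)
    (hr.smul (ha.of_le (by norm_num))) (hh.of_le (by norm_num)) hφ h0 h1
    (smul_ne_zero hr0.ne' ha0) ?_ ?_ ?_ ?_ ?_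
  · intro v hv hvw
    rw [hker0] at hv
    refine hcontact v hv fun w hw ↦ ?_
    have := hvw w ((hker0 w).2 hw)
    rw [extDerivForm_smul had.self_of_nhds (hr.differentiableAt (by norm_num)), hv, hw] at this
    simpa [hr0.ne'] using this
  · intro v hv hvw
    exact hnd v ((hker0 v).1 hv) fun w hw ↦ hvw w ((hker0 w).2 hw)
  · filter_upwards [hker, hsymm] with x hx1 hx2 v w hv hw
    exact hx2 v w ((hx1 v).1 hv) ((hx1 w).1 hw)
  · filter_upwards [hal, hlr] with x hx1 hx2 v
    simp only [smul_apply, smul_eq_mul, hx1]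
    rw [← hx2]; ring
  · filter_upwards [hker, hinvh] with x hx1 hx2 v w hv hw
    exact hx2 v w ((hx1 v).1 hv) ((hx1 w).1 hw)

end Euclidean

/-! ### Reading maps and vector fields in charts; the connectedness argument. -/

section ChartReading

open Filter Topology

variable {E : Type*} [NormedAddCommGroup E] [NormedSpace ℝ E] {M : Type*} [TopologicalSpace M]
  [ChartedSpace E M]

theorem tangentBundle_mk_congr {p p' : M} (h : p = p') (v : E) :
    (⟨p, v⟩ : TangentBundle 𝓘(ℝ, E) M) = ⟨p', v⟩ := by
  subst h; rfl

/-- The differential of the inverse of the preferred chart at `q`, as a map of the model space. -/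
noncomputable def chartSymmDeriv (E : Type*) [NormedAddCommGroup E] [NormedSpace ℝ E]
    {M : Type*} [TopologicalSpace M] [ChartedSpace E M] (q : M) (y : E) : E →L[ℝ] E :=
  mfderiv 𝓘(ℝ, E) 𝓘(ℝ, E) (extChartAt 𝓘(ℝ, E) q).symm y

/-- A self-map of `M` read in the preferred chart at `q`. -/
noncomputable def inChartMap (E : Type*) [NormedAddCommGroup E] [NormedSpace ℝ E]
    {M : Type*} [TopologicalSpace M] [ChartedSpace E M] (φ : M → M) (q : M) (y : E) : E :=
  extChartAt 𝓘(ℝ, E) q (φ ((extChartAt 𝓘(ℝ, E) q).symm y))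

variable [IsManifold 𝓘(ℝ, E) ∞ M]

theorem contMDiffAt_extChartAt_symm_of_mem (q : M) {y : E}
    (hy : y ∈ (extChartAt 𝓘(ℝ, E) q).target) :
    ContMDiffAt 𝓘(ℝ, E) 𝓘(ℝ, E) ∞ (extChartAt 𝓘(ℝ, E) q).symm y :=
  (contMDiffOn_extChartAt_symm q).contMDiffAt ((isOpen_extChartAt_target q).mem_nhds hy)

/-- Pushing a smooth vector field forward under the inverse chart gives a smooth map into the
tangent bundle. -/
theorem contMDiffOn_chartSymmDeriv (q : M) {X : E → E} {V : Set E}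
    (hV : V ⊆ (extChartAt 𝓘(ℝ, E) q).target) (hX : ContDiffOn ℝ ∞ X V) :
    ContMDiffOn 𝓘(ℝ, E) 𝓘(ℝ, E).tangent ∞ (fun y ↦ (⟨(extChartAt 𝓘(ℝ, E) q).symm y,
      chartSymmDeriv E q y (X y)⟩ : TangentBundle 𝓘(ℝ, E) M)) V := by
  have : IsManifold 𝓘(ℝ, E) 1 M := IsManifold.of_le (n := ∞) (by simp)
  have hto : IsOpen (extChartAt 𝓘(ℝ, E) q).target := isOpen_extChartAt_target q
  have h1 := (contMDiffOn_extChartAt_symm (I := 𝓘(ℝ, E)) (n := ∞) q).contMDiffOn_tangentMapWithin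
    (m := ∞) (by simp) hto.uniqueMDiffOn
  have h2 : ContMDiffOn 𝓘(ℝ, E) 𝓘(ℝ, E).tangent ∞
      (fun y ↦ (⟨y, X y⟩ : TangentBundle 𝓘(ℝ, E) E)) V :=
    contMDiffOn_vectorSpace_iff_contDiffOn.2 hX
  refine (h1.comp h2 fun y hy ↦ hV hy).congr fun y hy ↦ ?_
  simp only [Function.comp, tangentMapWithin, chartSymmDeriv]
  rw [mfderivWithin_of_isOpen hto (hV hy)]
  rfl

/-- Transporting a smooth vector field on the model space to the manifold. -/
theorem contMDiffOn_chart_vectorField (q : M) {X : E → E} {V : Set E}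
    (hV : V ⊆ (extChartAt 𝓘(ℝ, E) q).target) (hX : ContDiffOn ℝ ∞ X V) :
    ContMDiffOn 𝓘(ℝ, E) 𝓘(ℝ, E).tangent ∞
      (fun p ↦ (⟨p, chartSymmDeriv E q (extChartAt 𝓘(ℝ, E) q p) (X (extChartAt 𝓘(ℝ, E) q p))⟩ :
        TangentBundle 𝓘(ℝ, E) M))
      ((extChartAt 𝓘(ℝ, E) q).source ∩ extChartAt 𝓘(ℝ, E) q ⁻¹' V) := by
  have h1 : ContMDiffOn 𝓘(ℝ, E) 𝓘(ℝ, E) ∞ (extChartAt 𝓘(ℝ, E) q)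
      ((extChartAt 𝓘(ℝ, E) q).source ∩ extChartAt 𝓘(ℝ, E) q ⁻¹' V) := by
    refine (contMDiffOn_extChartAt (x := q)).mono ?_
    rw [← extChartAt_source 𝓘(ℝ, E) q]
    exact Set.inter_subset_left
  refine ((contMDiffOn_chartSymmDeriv q hV hX).comp h1 fun p hp ↦ hp.2).congr fun p hp ↦ ?_
  exact (tangentBundle_mk_congr ((extChartAt 𝓘(ℝ, E) q).left_inv hp.1) _).symm

theorem mfderiv_extChartAt_chartSymmDeriv (q : M) {y : E}
    (hy : y ∈ (extChartAt 𝓘(ℝ, E) q).target) (v : E) :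
    (mfderiv 𝓘(ℝ, E) 𝓘(ℝ, E) (extChartAt 𝓘(ℝ, E) q) ((extChartAt 𝓘(ℝ, E) q).symm y) : E → E)
      (chartSymmDeriv E q y v) = v := by
  have : IsManifold 𝓘(ℝ, E) 1 M := IsManifold.of_le (n := ∞) (by simp)
  have h := mfderiv_extChartAt_comp_mfderivWithin_extChartAt_symm (I := 𝓘(ℝ, E)) (x := q) hy
  simp only [modelWithCornersSelf_coe, Set.range_id, mfderivWithin_univ] at h
  exact congr($h v)

theorem chartSymmDeriv_mfderiv_extChartAt (q : M) {y : E}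
    (hy : y ∈ (extChartAt 𝓘(ℝ, E) q).target) (v : E) :
    chartSymmDeriv E q y ((mfderiv 𝓘(ℝ, E) 𝓘(ℝ, E) (extChartAt 𝓘(ℝ, E) q)
      ((extChartAt 𝓘(ℝ, E) q).symm y) : E → E) v) = v := by
  have : IsManifold 𝓘(ℝ, E) 1 M := IsManifold.of_le (n := ∞) (by simp)
  have h := mfderivWithin_extChartAt_symm_comp_mfderiv_extChartAt (I := 𝓘(ℝ, E)) (x := q) hy
  simp only [modelWithCornersSelf_coe, Set.range_id, mfderivWithin_univ] at h
  exact congr($h v)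

/-- The differential of a map read in a chart. -/
theorem chartSymmDeriv_fderiv_inChartMap (q : M) {φ : M → M} {y : E}
    (hy : y ∈ (extChartAt 𝓘(ℝ, E) q).target)
    (hφ : ContMDiffAt 𝓘(ℝ, E) 𝓘(ℝ, E) ∞ φ ((extChartAt 𝓘(ℝ, E) q).symm y))
    (hφy : φ ((extChartAt 𝓘(ℝ, E) q).symm y) ∈ (extChartAt 𝓘(ℝ, E) q).source) (v : E) :
    chartSymmDeriv E q (inChartMap E φ q y) (fderiv ℝ (inChartMap E φ q) y v) =
      (mfderiv 𝓘(ℝ, E) 𝓘(ℝ, E) φ ((extChartAt 𝓘(ℝ, E) q).symm y) : E → E)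
        (chartSymmDeriv E q y v) := by
  have : IsManifold 𝓘(ℝ, E) 1 M := IsManifold.of_le (n := ∞) (by simp)
  set e := extChartAt 𝓘(ℝ, E) q with he
  have d1 : HasMFDerivAt 𝓘(ℝ, E) 𝓘(ℝ, E) e.symm y (chartSymmDeriv E q y) :=
    ((contMDiffAt_extChartAt_symm_of_mem q hy).mdifferentiableAt (by simp)).hasMFDerivAt
  have d2 := (hφ.mdifferentiableAt (by simp)).hasMFDerivAt
  have d21 := HasMFDerivAt.comp y d2 d1
  have d3 : HasMFDerivAt 𝓘(ℝ, E) 𝓘(ℝ, E) e (φ (e.symm y)) _ :=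
    (mdifferentiableAt_extChartAt (by rwa [← extChartAt_source 𝓘(ℝ, E)])).hasMFDerivAt
  have d321 : MDifferentiableAt 𝓘(ℝ, E) 𝓘(ℝ, E) (inChartMap E φ q) y :=
    (HasMFDerivAt.comp y d3 d21).mdifferentiableAt
  have d4 : HasMFDerivAt 𝓘(ℝ, E) 𝓘(ℝ, E) (inChartMap E φ q) y
      (fderiv ℝ (inChartMap E φ q) y) := by
    have := d321.hasMFDerivAt
    rwa [mfderiv_eq_fderiv] at this
  have d5 : HasMFDerivAt 𝓘(ℝ, E) 𝓘(ℝ, E) e.symm (inChartMap E φ q y)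
      (chartSymmDeriv E q (inChartMap E φ q y)) :=
    ((contMDiffAt_extChartAt_symm_of_mem q (e.map_source hφy)).mdifferentiableAt
      (by simp)).hasMFDerivAt
  have d54 := HasMFDerivAt.comp y d5 d4
  -- The formula comes from differentiating the two sides of this intertwining relation.
  have hev : φ ∘ e.symm =ᶠ[𝓝 y] e.symm ∘ inChartMap E φ q := by
    have hc : ContinuousAt (fun z ↦ φ (e.symm z)) y :=
      hφ.continuousAt.comp (contMDiffAt_extChartAt_symm_of_mem q hy).continuousAt
    filter_upwards [hc.eventually ((isOpen_extChartAt_source q).mem_nhds hφy)] with z hz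
    exact (e.left_inv hz).symm
  have := hasMFDerivAt_unique (d54.congr_of_eventuallyEq hev) d21
  exact congr(($this : E →L[ℝ] E) v)

theorem contDiffAt_inChartMap (q : M) {φ : M → M} {y : E}
    (hy : y ∈ (extChartAt 𝓘(ℝ, E) q).target)
    (hφ : ContMDiffAt 𝓘(ℝ, E) 𝓘(ℝ, E) ∞ φ ((extChartAt 𝓘(ℝ, E) q).symm y))
    (hφy : φ ((extChartAt 𝓘(ℝ, E) q).symm y) ∈ (extChartAt 𝓘(ℝ, E) q).source) :
    ContDiffAt ℝ ∞ (inChartMap E φ q) y := by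
  rw [← contMDiffAt_iff_contDiffAt]
  have h1 := hφ.comp y (contMDiffAt_extChartAt_symm_of_mem q hy)
  have h2 : ContMDiffAt 𝓘(ℝ, E) 𝓘(ℝ, E) ∞ (extChartAt 𝓘(ℝ, E) q)
      (φ ((extChartAt 𝓘(ℝ, E) q).symm y)) :=
    contMDiffAt_extChartAt' (by rwa [← extChartAt_source 𝓘(ℝ, E)])
  exact ContMDiffAt.comp y h2 h1

/-- A smooth self-map of a connected Hausdorff manifold is the identity as soon as it has the
one-jet of the identity at some point and having the one-jet of the identity at a point forces it
to be the identity nearby. -/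
theorem eq_id_of_local_rigidity [T2Space M] [PreconnectedSpace M] {φ : M → M}
    (hφ : ContMDiff 𝓘(ℝ, E) 𝓘(ℝ, E) ∞ φ)
    (hloc : ∀ q, φ q = q → fderiv ℝ (inChartMap E φ q) (extChartAt 𝓘(ℝ, E) q q)
      = ContinuousLinearMap.id ℝ E → ∀ᶠ p in 𝓝 q, φ p = p)
    {q₀ : M} (h0 : φ q₀ = q₀) (h1 : fderiv ℝ (inChartMap E φ q₀) (extChartAt 𝓘(ℝ, E) q₀ q₀)
      = ContinuousLinearMap.id ℝ E) (q : M) : φ q = q := by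
  let F : Set M := {q | ∀ᶠ p in 𝓝 q, φ p = p}
  have hFo : IsOpen F := isOpen_setOfPred_eventually_nhds
  have hFc : IsClosed F := by
    refine isClosed_of_closure_subset fun q hq ↦ ?_
    have hq0 : φ q = q := by
      have : closure F ⊆ {p | φ p = p} :=
        (isClosed_eq hφ.continuous continuous_id).closure_subset_iff.2 fun p hp ↦
          Filter.Eventually.self_of_nhds hp
      exact this hq
    refine hloc q hq0 ?_
    set e := extChartAt 𝓘(ℝ, E) q with he
    have hsymm : e.symm (e q) = q := extChartAt_to_inv q
    have hψ : ContDiffAt ℝ ∞ (inChartMap E φ q) (e q) :=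
      contDiffAt_inChartMap q (mem_extChartAt_target q) hφ.contMDiffAt
        (by rw [hsymm, hq0]; exact mem_extChartAt_source q)
    have hc : ContinuousAt (fderiv ℝ (inChartMap E φ q)) (e q) :=
      (hψ.fderiv_right (m := 1) (by norm_num; exact ENat.LEInfty.out)).continuousAt
    have ht : Tendsto (fun p ↦ fderiv ℝ (inChartMap E φ q) (e p)) (𝓝 q)
        (𝓝 (fderiv ℝ (inChartMap E φ q) (e q))) :=
      hc.tendsto.comp (continuousAt_extChartAt q)
    -- All derivatives are taken in the one chart at `q`, so they lie in a fixed space. They equal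
    -- the identity at points of `F` accumulating at `q`, hence at `q` by continuity.
    have hfr : ∃ᶠ p in 𝓝 q, fderiv ℝ (inChartMap E φ q) (e p)
        ∈ ({ContinuousLinearMap.id ℝ E} : Set (E →L[ℝ] E)) := by
      refine ((mem_closure_iff_frequently.1 hq).and_eventually
        (extChartAt_source_mem_nhds (I := 𝓘(ℝ, E)) q)).mono fun p ⟨hp, hps⟩ ↦ ?_
      have hpt : e p ∈ e.target := e.map_source hps
      have hcs : Tendsto e.symm (𝓝 (e p)) (𝓝 p) := by
        have := (contMDiffAt_extChartAt_symm_of_mem q hpt).continuousAt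
        rw [ContinuousAt, ← he, e.left_inv hps] at this
        exact this
      have : inChartMap E φ q =ᶠ[𝓝 (e p)] id := by
        filter_upwards [hcs.eventually hp, (isOpen_extChartAt_target q).mem_nhds hpt] with y hy hyt
        simp only [inChartMap, ← he, hy, id]
        exact e.right_inv hyt
      rw [Set.mem_singleton_iff, this.fderiv_eq, fderiv_id]
    exact isClosed_singleton.mem_of_frequently_of_tendsto hfr ht
  have hF : F = Set.univ := IsClopen.eq_univ ⟨hFc, hFo⟩ ⟨q₀, hloc q₀ h0 h1⟩
  have : q ∈ F := hF ▸ Set.mem_univ q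
  exact Filter.Eventually.self_of_nhds (p := fun p ↦ φ p = p) this

end ChartReading

/-! ### From contact structures on manifolds to germs in a chart. -/

section ContactStructure

open Filter Topology

variable {n : ℕ} {M : Type*} [TopologicalSpace M]
  [ChartedSpace (EuclideanSpace ℝ (Fin (2 * n + 1))) M]

/-- Links the alternating-form derivative in `OneForm.d` to the bilinear form of the Euclidean part.
-/
theorem extDeriv_ofSubsingleton {E : Type*} [NormedAddCommGroup E] [NormedSpace ℝ E]
    {a : E → E →L[ℝ] ℝ} {x : E} (ha : DifferentiableAt ℝ a x) (v w : E) :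
    extDeriv (fun y ↦ ContinuousAlternatingMap.ofSubsingleton ℝ E ℝ (0 : Fin 1) (a y)) x ![v, w]
      = extDerivForm a x v w := by
  have hd : DifferentiableAt ℝ
      (fun y ↦ ContinuousAlternatingMap.ofSubsingleton ℝ E ℝ (0 : Fin 1) (a y)) x :=
    (ContinuousAlternatingMap.ofSubsingletonLIE (𝕜 := ℝ) (E := E) (F := ℝ)
      (0 : Fin 1)).differentiable.differentiableAt.comp x ha
  have hf : ∀ u z : E, fderiv ℝ (fun y ↦ a y u) x z = fderiv ℝ a x z u := fun u z ↦ by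
    rw [fderiv_clm_apply ha (differentiableAt_const u)]
    simp
  rw [extDeriv_apply hd, Fin.sum_univ_two, extDerivForm_apply, ← hf w v, ← hf v w]
  simp [Fin.removeNth, sub_eq_add_neg]

variable [IsManifold (𝓡 (2 * n + 1)) ∞ M]

/-- In finite dimension it suffices to test on constant vectors, and these push forward to smooth
vector fields, on which `α` is smooth. -/
theorem OneForm.SmoothOn.contDiffOn_inChart {α : OneForm n M} {U : Set M} (hα : α.SmoothOn U)
    (q : M) : ContDiffOn ℝ ∞ (α.inChart q) ((extChartAt (𝓡 (2 * n + 1)) q).target ∩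
      (extChartAt (𝓡 (2 * n + 1)) q).symm ⁻¹' U) := by
  rw [contDiffOn_clm_apply]
  intro v
  have h1 := contMDiffOn_chartSymmDeriv q (Set.inter_subset_left
    (t := (extChartAt (𝓡 (2 * n + 1)) q).symm ⁻¹' U)) (contDiffOn_const (c := v))
  have h2 := ContMDiffOn.comp hα ((contMDiffOn_extChartAt_symm (I := 𝓡 (2 * n + 1)) q).mono
    Set.inter_subset_left) (fun y hy ↦ hy.2)
  have h3 := ContMDiffOn.clm_bundle_apply (F₂ := ℝ) (E₂ := Bundle.Trivial M ℝ)
    (b := (extChartAt (𝓡 (2 * n + 1)) q).symm) h2 h1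
  rw [← contMDiffOn_iff_contDiffOn]
  intro y hy
  have h4 := (Bundle.contMDiffWithinAt_totalSpace.1 (h3 y hy)).2
  exact h4

/-- Compose with a linear projection onto `D q`. The choice is made point by point with no
regularity in `q`; only the values on `D q` matter, and these no longer carry membership proofs. -/
theorem Structure.exists_bilin_extension (S : Structure n M) (q : M) :
    ∃ B : LinearMap.BilinForm ℝ (EuclideanSpace ℝ (Fin (2 * n + 1))),
      ∀ v w : S.D q, B v.1 w.1 = S.g q v w := by
  obtain ⟨p, hp⟩ := (S.D q).subtype.exists_leftInverse_of_injective (S.D q).ker_subtype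
  refine ⟨(S.g q).compl₁₂ p p, fun v w ↦ ?_⟩
  have hp' : ∀ v : S.D q, p v = v := fun v ↦ congr($hp v)
  exact congrArg₂ (fun v w ↦ S.g q v w) (hp' v) (hp' w)

/-- An extension of the metric on `D q` to a bilinear form on the whole tangent space. -/
noncomputable def Structure.extendedMetric (S : Structure n M) (q : M) :
    LinearMap.BilinForm ℝ (EuclideanSpace ℝ (Fin (2 * n + 1))) :=
  (S.exists_bilin_extension q).choose

theorem Structure.extendedMetric_apply (S : Structure n M) {q : M}
    {v w : TangentSpace (𝓡 (2 * n + 1)) q} (hv : v ∈ S.D q) (hw : w ∈ S.D q) :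
    S.extendedMetric q v w = S.g q ⟨v, hv⟩ ⟨w, hw⟩ :=
  (S.exists_bilin_extension q).choose_spec ⟨v, hv⟩ ⟨w, hw⟩

/-- A self-map whose differential preserves the distribution and the metric on it. -/
def PreservesStructure (S : Structure n M) (φ : M → M) : Prop :=
  ∀ (q : M) (v w : TangentSpace (𝓡 (2 * n + 1)) q), v ∈ S.D q → w ∈ S.D q →
    mfderiv (𝓡 (2 * n + 1)) (𝓡 (2 * n + 1)) φ q v ∈ S.D (φ q) ∧
      S.extendedMetric (φ q) (mfderiv (𝓡 (2 * n + 1)) (𝓡 (2 * n + 1)) φ q v)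
        (mfderiv (𝓡 (2 * n + 1)) (𝓡 (2 * n + 1)) φ q w) = S.extendedMetric q v w

theorem IsIsometry.preservesStructure {S : Structure n M}
    {f : Diffeomorph (𝓡 (2 * n + 1)) (𝓡 (2 * n + 1)) M M ∞} (hf : IsIsometry S f) :
    PreservesStructure S f := by
  intro q v w hv hw
  have h : ∀ v ∈ S.D q, mfderiv (𝓡 (2 * n + 1)) (𝓡 (2 * n + 1)) f q v ∈ S.D (f q) := fun v hv ↦
    hf.map_eq q ▸ Submodule.mem_map_of_mem hv
  refine ⟨h v hv, ?_⟩
  rw [S.extendedMetric_apply (h v hv) (h w hw), S.extendedMetric_apply hv hw]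
  exact hf.isometry q ⟨v, hv⟩ ⟨w, hw⟩

/-- Both properties are read off from `df₁ ∘ dφ = df₂`: since `df₁` is injective and maps `D` onto
`D`, a vector with image in `D` already lies in `D`. -/
theorem IsIsometry.preservesStructure_symm_comp {S : Structure n M}
    {f₁ f₂ : Diffeomorph (𝓡 (2 * n + 1)) (𝓡 (2 * n + 1)) M M ∞} (hf₁ : IsIsometry S f₁)
    (hf₂ : IsIsometry S f₂) : PreservesStructure S (f₁.symm ∘ f₂) := by
  intro q v w hv hw
  set φ : M → M := f₁.symm ∘ f₂ with hφ
  have hφd : MDifferentiableAt (𝓡 (2 * n + 1)) (𝓡 (2 * n + 1)) φ q :=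
    ((f₁.symm.contMDiff.comp f₂.contMDiff).mdifferentiable (by simp)) q
  have hf₁d : ∀ p, MDifferentiableAt (𝓡 (2 * n + 1)) (𝓡 (2 * n + 1)) f₁ p :=
    f₁.contMDiff.mdifferentiable (by simp)
  have hcomp : f₁ ∘ φ = f₂ := by ext p; simp [hφ]
  have hq : f₁ (φ q) = f₂ q := congrFun hcomp q
  have hd : ∀ u : EuclideanSpace ℝ (Fin (2 * n + 1)),
      (mfderiv (𝓡 (2 * n + 1)) (𝓡 (2 * n + 1)) f₁ (φ q)
        (mfderiv (𝓡 (2 * n + 1)) (𝓡 (2 * n + 1)) φ q u) : EuclideanSpace ℝ (Fin (2 * n + 1))) =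
      mfderiv (𝓡 (2 * n + 1)) (𝓡 (2 * n + 1)) f₂ q u := by
    intro u
    have h1 := mfderiv_comp q (hf₁d (φ q)) hφd
    have h2 : mfderiv (𝓡 (2 * n + 1)) (𝓡 (2 * n + 1)) f₂ q
        = (mfderiv (𝓡 (2 * n + 1)) (𝓡 (2 * n + 1)) (f₁ ∘ φ) q : _ →L[ℝ] _) := by
      rw [hcomp]
    rw [h2, h1]
    rfl
  have hinj : Function.Injective (mfderiv (𝓡 (2 * n + 1)) (𝓡 (2 * n + 1)) f₁ (φ q)) :=
    (f₁.mfderivToContinuousLinearEquiv (by simp) (φ q)).injective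
  have hmem : ∀ u ∈ S.D q, mfderiv (𝓡 (2 * n + 1)) (𝓡 (2 * n + 1)) φ q u ∈ S.D (φ q) := by
    intro u hu
    have h1 : mfderiv (𝓡 (2 * n + 1)) (𝓡 (2 * n + 1)) f₂ q u ∈ S.D (f₂ q) :=
      hf₂.map_eq q ▸ Submodule.mem_map_of_mem hu
    have hD : ∀ {p p' : M}, p = p' → ∀ z : EuclideanSpace ℝ (Fin (2 * n + 1)),
        z ∈ S.D p → z ∈ S.D p' := by
      rintro p _ rfl z hz; exact hz
    have h2 := hD hq.symm _ h1
    rw [← hf₁.map_eq] at h2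
    obtain ⟨z, hz, hzu⟩ := h2
    have : z = mfderiv (𝓡 (2 * n + 1)) (𝓡 (2 * n + 1)) φ q u := hinj (hzu.trans (hd u).symm)
    exact this ▸ hz
  refine ⟨hmem v hv, ?_⟩
  rw [← (hf₁.preservesStructure (φ q) _ _ (hmem v hv) (hmem w hw)).2,
    ← (hf₂.preservesStructure q v w hv hw).2]
  have hE : ∀ {p p' : M}, p = p' → ∀ z z' : EuclideanSpace ℝ (Fin (2 * n + 1)),
      S.extendedMetric p z z' = S.extendedMetric p' z z' := by
    rintro p _ rfl z z'; rfl
  have := hE hq (mfderiv (𝓡 (2 * n + 1)) (𝓡 (2 * n + 1)) f₂ q v)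
    (mfderiv (𝓡 (2 * n + 1)) (𝓡 (2 * n + 1)) f₂ q w)
  rw [← this]
  exact congrArg₂ (fun z z' ↦ S.extendedMetric (f₁ (φ q)) z z') (hd v) (hd w)

/-- The extended metric read in the preferred chart at `q`. -/
noncomputable def Structure.metricInChart (S : Structure n M) (q : M)
    (y : EuclideanSpace ℝ (Fin (2 * n + 1))) :
    LinearMap.BilinForm ℝ (EuclideanSpace ℝ (Fin (2 * n + 1))) :=
  (S.extendedMetric ((extChartAt (𝓡 (2 * n + 1)) q).symm y)).compl₁₂
    (chartSymmDeriv _ q y).toLinearMap (chartSymmDeriv _ q y).toLinearMap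

theorem Structure.metricInChart_apply (S : Structure n M) (q : M)
    (y v w : EuclideanSpace ℝ (Fin (2 * n + 1))) :
    S.metricInChart q y v w = S.extendedMetric ((extChartAt (𝓡 (2 * n + 1)) q).symm y)
      (chartSymmDeriv _ q y v) (chartSymmDeriv _ q y w) := rfl

/-- The metric read in a chart is smooth on smooth sections of the distribution. -/
theorem Structure.contDiffOn_metricInChart (S : Structure n M) (q : M)
    {V : Set (EuclideanSpace ℝ (Fin (2 * n + 1)))} (hVo : IsOpen V)
    (hV : V ⊆ (extChartAt (𝓡 (2 * n + 1)) q).target)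
    {X Y : EuclideanSpace ℝ (Fin (2 * n + 1)) → EuclideanSpace ℝ (Fin (2 * n + 1))}
    (hX : ContDiffOn ℝ ∞ X V) (hY : ContDiffOn ℝ ∞ Y V)
    (hXD : ∀ y ∈ V, chartSymmDeriv _ q y (X y) ∈ S.D ((extChartAt (𝓡 (2 * n + 1)) q).symm y))
    (hYD : ∀ y ∈ V, chartSymmDeriv _ q y (Y y) ∈ S.D ((extChartAt (𝓡 (2 * n + 1)) q).symm y)) :
    ContDiffOn ℝ ∞ (fun y ↦ S.metricInChart q y (X y) (Y y)) V := by
  classical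
  set e := extChartAt (𝓡 (2 * n + 1)) q with he
  let U : Set M := e.source ∩ e ⁻¹' V
  have hU : IsOpen U := (continuousOn_extChartAt q).isOpen_inter_preimage (isOpen_extChartAt_source q) hVo
  have hsec : ∀ X : EuclideanSpace ℝ (Fin (2 * n + 1)) → EuclideanSpace ℝ (Fin (2 * n + 1)),
      ContDiffOn ℝ ∞ X V → (∀ y ∈ V, chartSymmDeriv _ q y (X y) ∈ S.D (e.symm y)) →
      ∃ Z : ∀ p, S.D p, SmoothSectionOn Z U ∧ ∀ y ∈ V, ∃ h, Z (e.symm y)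
        = ⟨chartSymmDeriv _ q y (X y), h⟩ := by
    intro X hX hXD
    have hD : ∀ {p p' : M}, p = p' → ∀ z : EuclideanSpace ℝ (Fin (2 * n + 1)),
        z ∈ S.D p → z ∈ S.D p' := by
      rintro p _ rfl z hz; exact hz
    -- The smoothness axiom takes globally defined sections, so the field is extended by zero; its
    -- smoothness is needed on `U` only.
    let Z : ∀ p, S.D p := fun p ↦ if hp : p ∈ U then
      ⟨chartSymmDeriv _ q (e p) (X (e p)), hD (e.left_inv hp.1) _ (hXD _ hp.2)⟩ else 0
    refine ⟨Z, ?_, fun y hy ↦ ⟨hXD y hy, ?_⟩⟩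
    · refine (contMDiffOn_chart_vectorField q hV hX).congr fun p hp ↦ ?_
      simp only [Z, dif_pos (show p ∈ U from hp)]
      rfl
    · have hyU : e.symm y ∈ U :=
        ⟨e.map_target (hV hy), by simpa [e.right_inv (hV hy)] using hy⟩
      apply Subtype.ext
      simp only [Z, dif_pos hyU]
      rw [e.right_inv (hV hy)]
  obtain ⟨ZX, hZX, hZX'⟩ := hsec X hX hXD
  obtain ⟨ZY, hZY, hZY'⟩ := hsec Y hY hYD
  have h1 := S.smooth U hU ZX ZY hZX hZY
  have h2 : ContMDiffOn 𝓘(ℝ, EuclideanSpace ℝ (Fin (2 * n + 1))) 𝓘(ℝ, ℝ) ∞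
      (fun y ↦ S.g (e.symm y) (ZX (e.symm y)) (ZY (e.symm y))) V :=
    ContMDiffOn.comp h1 ((contMDiffOn_extChartAt_symm (I := 𝓡 (2 * n + 1)) q).mono hV)
      fun y hy ↦ ⟨e.map_target (hV hy), by simpa [e.right_inv (hV hy)] using hy⟩
  refine (contMDiffOn_iff_contDiffOn.1 h2).congr fun y hy ↦ ?_
  obtain ⟨hx, hx'⟩ := hZX' y hy
  obtain ⟨hy, hy'⟩ := hZY' y hy
  rw [S.metricInChart_apply, S.extendedMetric_apply hx hy, hx', hy']

/-- Local rigidity of maps preserving a contact sub-pseudo-Riemannian structure. -/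
theorem PreservesStructure.eventually_eq_id {S : Structure n M} (hn : 1 ≤ n) {φ : M → M}
    (hφ : ContMDiff (𝓡 (2 * n + 1)) (𝓡 (2 * n + 1)) ∞ φ) (hS : PreservesStructure S φ) {q : M}
    (h0 : φ q = q)
    (h1 : fderiv ℝ (inChartMap (EuclideanSpace ℝ (Fin (2 * n + 1))) φ q)
      (extChartAt (𝓡 (2 * n + 1)) q q) = ContinuousLinearMap.id ℝ _) :
    ∀ᶠ p in 𝓝 q, φ p = p := by
  set e := extChartAt (𝓡 (2 * n + 1)) q with he
  obtain ⟨U, hUo, hqU, α, hα, hαU⟩ := S.contact q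
  set x₀ := e q with hx₀
  have hx₀t : x₀ ∈ e.target := mem_extChartAt_target q
  have hsymm : e.symm x₀ = q := extChartAt_to_inv q
  let a := α.inChart q
  let V := e.target ∩ e.symm ⁻¹' U
  have hVo : IsOpen V :=
    (continuousOn_extChartAt_symm q).isOpen_inter_preimage (isOpen_extChartAt_target q) hUo
  have hx₀V : x₀ ∈ V := ⟨hx₀t, by simpa [hsymm] using hqU⟩
  have ha : ContDiffOn ℝ ∞ a V := hα.contDiffOn_inChart q
  have haD : ∀ y ∈ V, ∀ v, a y v = 0 ↔ chartSymmDeriv _ q y v ∈ S.D (e.symm y) := fun y hy v ↦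
    ((hαU _ hy.2).2.1 _).symm
  have hsurj : ∀ y ∈ e.target, ∀ z : EuclideanSpace ℝ (Fin (2 * n + 1)),
      ∃ v, chartSymmDeriv _ q y v = z := fun y hy z ↦ ⟨_, chartSymmDeriv_mfderiv_extChartAt q hy z⟩
  have hinj : ∀ y ∈ e.target, ∀ v, chartSymmDeriv _ q y v = 0 → v = 0 := by
    intro y hy v hv
    rw [← mfderiv_extChartAt_chartSymmDeriv q hy v, hv]
    exact map_zero (mfderiv (𝓡 (2 * n + 1)) (𝓡 (2 * n + 1)) e (e.symm y))
  have ha0 : a x₀ ≠ 0 := by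
    intro h
    refine (hαU _ hx₀V.2).1 (ContinuousLinearMap.ext fun z ↦ ?_)
    obtain ⟨v, rfl⟩ := hsurj x₀ hx₀t z
    exact congr($h v)
  obtain ⟨h, hh, hhm⟩ := exists_smooth_bilin (h := S.metricInChart q) hVo hx₀V ha ha0
    fun V' hV' hVo' X Y hX hY hXD hYD ↦
      S.contDiffOn_metricInChart q hVo' (hV'.trans Set.inter_subset_left) hX hY
        (fun y hy ↦ (haD y (hV' hy) _).1 (hXD y hy)) (fun y hy ↦ (haD y (hV' hy) _).1 (hYD y hy))
  have hxs : φ (e.symm x₀) ∈ e.source := by rw [hsymm, h0]; exact mem_extChartAt_source q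
  set ψ := inChartMap (EuclideanSpace ℝ (Fin (2 * n + 1))) φ q with hψ
  have hψs : ContDiffAt ℝ ∞ ψ x₀ := contDiffAt_inChartMap q hx₀t hφ.contMDiffAt hxs
  have hψ0 : ψ x₀ = x₀ := by simp only [hψ, inChartMap, ← he]; rw [hsymm, h0]
  have hψc : Tendsto ψ (𝓝 x₀) (𝓝 x₀) := by simpa [ContinuousAt, hψ0] using hψs.continuousAt
  have hV : ∀ᶠ y in 𝓝 x₀, y ∈ V := hVo.mem_nhds hx₀V
  have hsrc : ∀ᶠ y in 𝓝 x₀, φ (e.symm y) ∈ e.source := by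
    have hc : ContinuousAt (fun y ↦ φ (e.symm y)) x₀ :=
      hφ.continuous.continuousAt.comp (contMDiffAt_extChartAt_symm_of_mem q hx₀t).continuousAt
    exact hc.eventually ((isOpen_extChartAt_source q).mem_nhds hxs)
  have hD : ∀ {p p' : M}, p = p' → ∀ z : EuclideanSpace ℝ (Fin (2 * n + 1)),
      z ∈ S.D p → z ∈ S.D p' := by
    rintro p _ rfl z hz; exact hz
  have hE : ∀ {p p' : M}, p = p' → ∀ z z' : EuclideanSpace ℝ (Fin (2 * n + 1)),
      S.extendedMetric p z z' = S.extendedMetric p' z z' := by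
    rintro p _ rfl z z'; rfl
  have hinva : ∀ᶠ y in 𝓝 x₀, ∀ v, a y v = 0 → a (ψ y) (fderiv ℝ ψ y v) = 0 := by
    filter_upwards [hV, hψc.eventually hV, hsrc] with y hy1 hy2 hy3 v hv
    rw [haD _ hy2, chartSymmDeriv_fderiv_inChartMap q hy1.1 hφ.contMDiffAt hy3]
    rw [haD _ hy1] at hv
    exact hD (e.left_inv hy3).symm _ (hS _ _ _ hv hv).1
  have main : ∀ᶠ y in 𝓝 x₀, ψ y = y := by
    refine eventually_eq_id_of_preserves_kernel (a := a) (h := h) ?_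
      ((ha.contDiffAt (hVo.mem_nhds hx₀V)).of_le ENat.LEInfty.out) (hh.of_le ENat.LEInfty.out)
      (hψs.of_le ENat.LEInfty.out) hψ0 h1 ha0 ?_ ?_ ?_ hinva ?_
    · rw [finrank_euclideanSpace_fin]; omega
    · intro v hv hvw
      have hda : DifferentiableAt ℝ a x₀ :=
        (ha.contDiffAt (hVo.mem_nhds hx₀V)).differentiableAt (by simp)
      -- The contact condition lives at `q`, the chart computation at `e.symm x₀`. A variable base
      -- point transports between these tangent spaces.
      have key : ∀ p, e.symm x₀ = p → ∀ z : EuclideanSpace ℝ (Fin (2 * n + 1)), z ∈ S.D p →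
          (∀ w : EuclideanSpace ℝ (Fin (2 * n + 1)), w ∈ S.D p →
            extDerivForm a x₀
              ((mfderiv (𝓡 (2 * n + 1)) (𝓡 (2 * n + 1)) e p : _ → _) z)
              ((mfderiv (𝓡 (2 * n + 1)) (𝓡 (2 * n + 1)) e p : _ → _) w) = 0) → z = 0 := by
        intro p hp z hz hzw
        obtain rfl : p = q := hp.symm.trans hsymm
        refine (hαU p hqU).2.2 z hz fun w hw ↦ ?_
        rw [← hzw w hw]
        exact extDeriv_ofSubsingleton hda _ _
      refine hinj x₀ hx₀t v (key _ rfl _ ((haD _ hx₀V v).1 hv) fun w hw ↦ ?_)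
      obtain ⟨w, rfl⟩ := hsurj x₀ hx₀t w
      have e1 := mfderiv_extChartAt_chartSymmDeriv q hx₀t v
      have e2 := mfderiv_extChartAt_chartSymmDeriv q hx₀t w
      rw [e1, e2]
      exact hvw w ((haD _ hx₀V w).2 hw)
    · intro v hv hvw
      have hv' := (haD _ hx₀V v).1 hv
      refine hinj x₀ hx₀t v ?_
      have := (S.nondegenerate (e.symm x₀)).1 ⟨_, hv'⟩ fun ⟨w, hw⟩ ↦ ?_
      · exact congrArg Subtype.val this
      · obtain ⟨w, rfl⟩ := hsurj x₀ hx₀t w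
        have hw' := (haD _ hx₀V w).2 hw
        rw [← S.extendedMetric_apply hv' hw, ← S.metricInChart_apply,
          ← hhm.self_of_nhds v w hv hw']
        exact hvw w hw'
    · filter_upwards [hV, hhm] with y hy1 hy2 v w hv hw
      have hv' := (haD _ hy1 v).1 hv
      have hw' := (haD _ hy1 w).1 hw
      rw [hy2 v w hv hw, hy2 w v hw hv, S.metricInChart_apply, S.metricInChart_apply,
        S.extendedMetric_apply hv' hw', S.extendedMetric_apply hw' hv']
      exact (S.symm _).eq _ _
    · filter_upwards [hV, hψc.eventually hV, hhm, hψc.eventually hhm, hsrc, hinva]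
        with y hy1 hy2 hy3 hy4 hy5 hy6 v w hv hw
      rw [hy4 _ _ (hy6 v hv) (hy6 w hw), hy3 v w hv hw, S.metricInChart_apply,
        S.metricInChart_apply, chartSymmDeriv_fderiv_inChartMap q hy1.1 hφ.contMDiffAt hy5,
        chartSymmDeriv_fderiv_inChartMap q hy1.1 hφ.contMDiffAt hy5]
      refine (hE (e.left_inv hy5) _ _).trans ?_
      exact (hS _ _ _ ((haD _ hy1 v).1 hv) ((haD _ hy1 w).1 hw)).2
  have hsrc' : ∀ᶠ p in 𝓝 q, φ p ∈ e.source :=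
    hφ.continuous.continuousAt.eventually
      ((isOpen_extChartAt_source q).mem_nhds (by rw [h0]; exact mem_extChartAt_source q))
  filter_upwards [(continuousAt_extChartAt (I := 𝓡 (2 * n + 1)) q).eventually main, hsrc',
    extChartAt_source_mem_nhds (I := 𝓡 (2 * n + 1)) q] with p hp1 hp2 hp3
  refine e.injOn hp2 hp3 ?_
  have : ψ (e p) = e (φ p) := by simp only [hψ, inChartMap, ← he]; rw [e.left_inv hp3]
  rw [← this]; exact hp1

/-- A map fixing `q` whose tangent map fixes the tangent vectors at `q` has the one-jet of the
identity at `q` in the preferred chart. -/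
theorem fderiv_inChartMap_eq_id {E : Type*} [NormedAddCommGroup E] [NormedSpace ℝ E] {M : Type*}
    [TopologicalSpace M] [ChartedSpace E M] [IsManifold 𝓘(ℝ, E) ∞ M] {φ : M → M}
    (hφ : ContMDiff 𝓘(ℝ, E) 𝓘(ℝ, E) ∞ φ) {q : M} (h0 : φ q = q)
    (h1 : ∀ v : E, (mfderiv 𝓘(ℝ, E) 𝓘(ℝ, E) φ q : E → E) v = v) :
    fderiv ℝ (inChartMap E φ q) (extChartAt 𝓘(ℝ, E) q q) = ContinuousLinearMap.id ℝ E := by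
  set e := extChartAt 𝓘(ℝ, E) q with he
  have hsymm : e.symm (e q) = q := extChartAt_to_inv q
  have ht : e q ∈ e.target := mem_extChartAt_target q
  ext v
  have h := chartSymmDeriv_fderiv_inChartMap q (φ := φ) ht hφ.contMDiffAt
    (by rw [hsymm, h0]; exact mem_extChartAt_source q) v
  have hψ0 : inChartMap E φ q (e q) = e q := by simp only [inChartMap, ← he]; rw [hsymm, h0]
  have key : ∀ p, p = q → ∀ z : E, (mfderiv 𝓘(ℝ, E) 𝓘(ℝ, E) φ p : E → E) z = z := by
    rintro p rfl z; exact h1 z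
  rw [hψ0, key _ hsymm] at h
  have h2 := mfderiv_extChartAt_chartSymmDeriv q ht (fderiv ℝ (inChartMap E φ q) (e q) v)
  rw [h, mfderiv_extChartAt_chartSymmDeriv q ht v] at h2
  exact h2.symm

end ContactStructure

end ContactSPR

/-! ### Uniqueness of isometries with a given one-jet. -/

/-- Equality of differentials is expressed through `tangentMap` because the two derivatives take
values in the tangent spaces at `f₁ q₀` and `f₂ q₀`, which are not the same type by definition. -/
theorem mainTheorem12 (n : ℕ) (hn : 1 ≤ n) (M : Type*) [TopologicalSpace M] [T2Space M]
    [ConnectedSpace M] [ChartedSpace (EuclideanSpace ℝ (Fin (2 * n + 1))) M]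
    [IsManifold (𝓡 (2 * n + 1)) ∞ M] (S : ContactSPR.Structure n M)
    (f₁ f₂ : Diffeomorph (𝓡 (2 * n + 1)) (𝓡 (2 * n + 1)) M M ∞)
    (hf₁ : ContactSPR.IsIsometry S f₁) (hf₂ : ContactSPR.IsIsometry S f₂)
    (q₀ : M) (h₀ : f₁ q₀ = f₂ q₀)
    (h₁ : ∀ v : TangentSpace (𝓡 (2 * n + 1)) q₀,
      tangentMap (𝓡 (2 * n + 1)) (𝓡 (2 * n + 1)) f₁ ⟨q₀, v⟩ =
        tangentMap (𝓡 (2 * n + 1)) (𝓡 (2 * n + 1)) f₂ ⟨q₀, v⟩) :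
    f₁ = f₂ := by
  have hφ : ContMDiff (𝓡 (2 * n + 1)) (𝓡 (2 * n + 1)) ∞ (f₁.symm ∘ f₂) :=
    f₁.symm.contMDiff.comp f₂.contMDiff
  have h0 : (f₁.symm ∘ f₂) q₀ = q₀ := by simp [← h₀]
  have hT : ∀ v : TangentSpace (𝓡 (2 * n + 1)) q₀,
      tangentMap (𝓡 (2 * n + 1)) (𝓡 (2 * n + 1)) (f₁.symm ∘ f₂) ⟨q₀, v⟩ = ⟨q₀, v⟩ := by
    intro v
    have hs := f₁.symm.contMDiff.mdifferentiable (by simp)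
    rw [tangentMap_comp_at _ (hs _) (f₂.contMDiff.mdifferentiable (by simp) _), ← h₁,
      ← tangentMap_comp_at _ (hs _) (f₁.contMDiff.mdifferentiable (by simp) _)]
    have : f₁.symm ∘ f₁ = id := by ext; simp
    rw [this, tangentMap_id]
    rfl
  have h1 := ContactSPR.fderiv_inChartMap_eq_id hφ h0 fun v ↦
    congrArg (fun p : TangentBundle (𝓡 (2 * n + 1)) M ↦
      (p.2 : EuclideanSpace ℝ (Fin (2 * n + 1)))) (hT v)
  have hid := ContactSPR.eq_id_of_local_rigidity hφ
    (fun q hq hq' ↦ (hf₁.preservesStructure_symm_comp hf₂).eventually_eq_id hn hφ hq hq') h0 h1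
  ext p
  simpa using (congrArg f₁ (hid p)).symm
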